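/- Proposition 3.2. Let $H$ be a Hopf algebra over a field $k$ with comultiplication $\Delta(h)=\sum h_{(1)}\otimes h_{(2)}$. All algebras are associative unital $k$-algebras. An $H$-module algebra is an algebra $B$ with a left $H$-module structure, compatible with its $k$-vector space structure, such that $h(ab)=\sum (h_{(1)}a)(h_{(2)}b)$ for all $h\in H$ and $a,b\in B$. It is $H$-simple if $B\neq 0$ and $0$ and $B$ are its only $H$-stable two-sided ideals, and $H$-semiprime if it has no nonzero nilpotent $H$-stable two-sided ideals. A ring is semiprimary if its Jacobson radical is nilpotent and the factor ring by the Jacobson radical is semisimple Artinian. Let $Q$ be a semiprimary $H$-semiprime $H$-module algebra containing an $H$-stable (unital) subalgebra $A$ such that the action of $H$ on $A$ is locally finite, i.e. $\dim_k Ha<\infty$ for all $a\in A$, and such that $I\cap A\neq 0$ for each nonzero right ideal $I$ of $Q$. Then there are an integer $n\ge 0$, $H$-simple $H$-module algebras $Q_1,\ldots,Q_n$ and an isomorphism of $H$-module algebras (an $H$-linear isomorphism of $k$-algebras) $$Q\cong Q_1\times\cdots\times Q_n ,$$ where $H$ acts componentwise on the product (with $n=0$ meaning $Q=0$). -/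

import Mathlib

universe u v w

/-- `Q` is a (left) `H`-module algebra for the Hopf algebra `H` over `k`: the `k`-algebra `Q` is a
left `H`-module, its two `k`-vector space structures agree (this is `IsScalarTower k H Q`), and
`h (a b) = ∑ (h₍₁₎ a) (h₍₂₎ b)`. The right-hand side is the image of `Δ h` under
`H ⊗ H → Q ⊗ Q → Q`, `x ⊗ y ↦ (x a) ⊗ (y b) ↦ (x a) (y b)`. -/
class HModuleAlgebra (k H Q : Type*) [Field k] [Ring H] [HopfAlgebra k H]
    [Ring Q] [Algebra k Q] [Module H Q] : Prop extends IsScalarTower k H Q where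
  smul_mul_eq : ∀ (h : H) (a b : Q),
    h • (a * b) =
      LinearMap.mul' k Q
        (TensorProduct.map
          ((LinearMap.toSpanSingleton H Q a).restrictScalars k)
          ((LinearMap.toSpanSingleton H Q b).restrictScalars k)
          (Coalgebra.comul (R := k) h))

/-- The defining law in Sweedler form. -/
theorem HModuleAlgebra.smul_mul_repr {k H Q : Type*} [Field k] [Ring H] [HopfAlgebra k H]
    [Ring Q] [Algebra k Q] [Module H Q] [HModuleAlgebra k H Q]
    {ι : Type*} {h : H} (r : Coalgebra.Repr k h ι) (a b : Q) :
    h • (a * b) = ∑ i ∈ r.index, (r.left i • a) * (r.right i • b) := by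
  rw [HModuleAlgebra.smul_mul_eq (k := k) h a b, ← r.eq]
  simp

/-- The unit law `h 1 = ε(h) 1` is a consequence of the multiplicative law and of the antipode. -/
theorem HModuleAlgebra.smul_one_eq {k H Q : Type*} [Field k] [Ring H] [HopfAlgebra k H]
    [Ring Q] [Algebra k Q] [Module H Q] [HModuleAlgebra k H Q] (h : H) :
    h • (1 : Q) = algebraMap k Q (Coalgebra.counit (R := k) h) := by
  -- `T (x ⊗ (y ⊗ z)) = (x 1) ((y S(z)) 1)`
  let σ : H →ₗ[k] Q := (LinearMap.toSpanSingleton H Q 1).restrictScalars k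
  let T : TensorProduct k H (TensorProduct k H H) →ₗ[k] Q :=
    LinearMap.mul' k Q ∘ₗ TensorProduct.map σ
      (σ ∘ₗ LinearMap.mul' k H ∘ₗ (HopfAlgebra.antipode k).lTensor H)
  have h1 : ∀ t : TensorProduct k H H,
      T (TensorProduct.assoc k H H H (Coalgebra.comul.rTensor H t)) =
        σ (LinearMap.mul' k H ((HopfAlgebra.antipode k).lTensor H t)) := by
    intro t
    induction t with
    | zero => simp
    | add x y hx hy => simp only [map_add, hx, hy]
    | tmul x y =>
      have hx := HModuleAlgebra.smul_mul_repr (Coalgebra.Repr.arbitrary k x) (1 : Q)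
        (HopfAlgebra.antipode k y • (1 : Q))
      rw [one_mul] at hx
      rw [LinearMap.rTensor_tmul, ← (Coalgebra.Repr.arbitrary k x).eq]
      simp only [TensorProduct.sum_tmul, map_sum, TensorProduct.assoc_tmul]
      simp [T, σ, mul_smul, hx]
  have h2 : ∀ t : TensorProduct k H H,
      T (Coalgebra.comul.lTensor H t) =
        LinearMap.mul' k Q (TensorProduct.map σ
          (Algebra.linearMap k Q ∘ₗ Coalgebra.counit) t) := by
    intro t
    induction t with
    | zero => simp
    | add x y hx hy => simp only [map_add, hx, hy]
    | tmul x y =>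
      simp [T, σ, HopfAlgebra.mul_antipode_lTensor_comul_apply, ← Algebra.commutes,
        ← Algebra.smul_def]
  have h3 := h1 (Coalgebra.comul h)
  rw [Coalgebra.coassoc_apply, h2, HopfAlgebra.mul_antipode_lTensor_comul_apply] at h3
  have h4 : ∀ t : TensorProduct k H H,
      LinearMap.mul' k Q (TensorProduct.map σ
          (Algebra.linearMap k Q ∘ₗ Coalgebra.counit) t) =
        σ (TensorProduct.rid k H (Coalgebra.counit.lTensor H t)) := by
    intro t
    induction t with
    | zero => simp
    | add x y hx hy => simp only [map_add, hx, hy]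
    | tmul x y => simp [σ, ← Algebra.commutes, ← Algebra.smul_def]
  rw [h4, Coalgebra.lTensor_counit_comul] at h3
  simpa [σ, Algebra.algebraMap_eq_smul_one] using h3

/-- A two-sided ideal that is stable under the action of `H`. -/
def TwoSidedIdeal.IsHStable (H : Type*) {Q : Type*} [Ring H] [Ring Q] [Module H Q]
    (I : TwoSidedIdeal Q) : Prop :=
  ∀ (h : H), ∀ x ∈ I, h • x ∈ I

/-- `Q` is `H`-simple: `Q ≠ 0`, and `0` and `Q` are the only `H`-stable two-sided ideals. -/
def IsHSimple (H Q : Type*) [Ring H] [Ring Q] [Module H Q] : Prop :=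
  Nontrivial Q ∧ ∀ I : TwoSidedIdeal Q, I.IsHStable H → I = ⊥ ∨ I = ⊤

/-- `Q` is `H`-semiprime: it has no nonzero nilpotent `H`-stable two-sided ideals. Powers of a
two-sided ideal are computed as powers of the underlying left ideal; they are the usual powers. -/
def IsHSemiprime (H Q : Type*) [Ring H] [Ring Q] [Module H Q] : Prop :=
  ∀ I : TwoSidedIdeal Q, I.IsHStable H → IsNilpotent (TwoSidedIdeal.asIdeal I) → I = ⊥

/-- A subalgebra that is stable under the action of `H`. -/
def Subalgebra.IsHStable {k : Type*} (H : Type*) {Q : Type*} [Field k] [Ring H]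
    [Ring Q] [Algebra k Q] [Module H Q] (A : Subalgebra k Q) : Prop :=
  ∀ (h : H), ∀ a ∈ A, h • a ∈ A

/-- The action of `H` on `A` is locally finite: `dim_k (H a) < ∞` for every `a ∈ A`. -/
def Subalgebra.IsLocallyFinite {k : Type*} (H : Type*) {Q : Type*} [Field k] [Ring H]
    [HopfAlgebra k H] [Ring Q] [Algebra k Q] [Module H Q] [IsScalarTower k H Q]
    (A : Subalgebra k Q) : Prop :=
  ∀ a ∈ A, FiniteDimensional k ((Submodule.span H {a}).restrictScalars k)

/-! Every nonzero $H$-stable right ideal $K$ contains some $0\neq a\in A$, hence the finitely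
generated $H$-stable right ideal $(Ha)Q$. As $Q$ is semiprimary, finitely generated right ideals
satisfy the descending chain condition, so $K$ contains a minimal $H$-stable right ideal $N=VQ$ with
$V$ a finite-dimensional $H$-submodule (`Submodule.exists_minimal_isHStableRight`).

The crux is that the right annihilator of $N$ is a maximal $H$-stable ideal
(`Submodule.exists_isHMaximal_annihilator`). Some power $N^l$ has generators $e_1,\dots,e_n$ whose
relations have all coefficients in a proper ideal. Let $I$ be the two-sided ideal generated by these
coefficients; then $N^l/N^lI$ is free over $Q/I$ on the $e_j$. Comparing $e$ with its $H$-translates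
in the convolution algebra $\mathrm{Hom}(H,Q)$ gives a one-sided inverse relation between matrices
modulo $I$. Since $\mathrm{Hom}(H,Q/I)$ is stably finite, it is two-sided, and this makes $I$ stable
under $H$ (`TwoSidedIdeal.isHStable_of_span_relations`). For an $H$-stable $I'\supseteq I$,
minimality gives $NI'=0$ or $NI'=N$, and the latter forces $I'=Q$. Hence $NI=0$, $I$ is the
annihilator, and it is maximal.

If the maximal $H$-stable ideals had nonzero intersection, such an $N$ would lie in it, hence in its
own right annihilator, so $N^2=0$ against $H$-semiprimeness. Distinct maximal $H$-stable ideals are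
comaximal, a semiprimary ring admits only finitely many such ideals, and the Chinese remainder
theorem finishes the proof. -/

/-! ### Modules over a ring that is semisimple modulo a nilpotent ideal. -/

section Semiprimary

variable {R : Type*} [Ring R] {J : Ideal R}

theorem Ideal.isSemisimpleModule_of_smul_eq_zero (J : Ideal R) [J.IsTwoSided]
    [IsSemisimpleRing (R ⧸ J)] {M : Type*}
    [AddCommGroup M] [Module R M] (h : ∀ r ∈ J, ∀ m : M, r • m = 0) : IsSemisimpleModule R M := by
  have h' : Module.IsTorsionBySet R M J := fun m a ↦ h a a.2 m
  let _ := h'.module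
  exact (h'.semilinearMap.isSemisimpleModule_iff_of_bijective Function.bijective_id).2
    inferInstance

theorem Ideal.isSemisimpleModule_quotient_smul_top (J : Ideal R) [J.IsTwoSided]
    [IsSemisimpleRing (R ⧸ J)] (M : Type*) [AddCommGroup M] [Module R M] :
    IsSemisimpleModule R (M ⧸ (J • ⊤ : Submodule R M)) := by
  refine J.isSemisimpleModule_of_smul_eq_zero fun r hr m ↦ ?_
  obtain ⟨m, rfl⟩ := Submodule.mkQ_surjective _ m
  rw [← map_smul]
  exact (Submodule.Quotient.mk_eq_zero _).mpr (Submodule.smul_mem_smul hr Submodule.mem_top)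

/-- Nakayama's lemma for nilpotent $J$: substituting the equation into itself gives $M=L+J^sM$ for
every $s$, without any finiteness of $M$. -/
theorem Submodule.eq_top_of_sup_smul_top_eq_top {M : Type*} [AddCommGroup M] [Module R M]
    (hJ : IsNilpotent J) {L : Submodule R M} (h : L ⊔ J • ⊤ = ⊤) : L = ⊤ := by
  obtain ⟨t, ht⟩ := hJ
  have key : ∀ s : ℕ, ⊤ ≤ L ⊔ J ^ s • (⊤ : Submodule R M) := by
    intro s
    induction s with
    | zero => simp [Submodule.pow_zero]
    | succ s ih =>
      refine ih.trans (sup_le le_sup_left ?_)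
      conv_lhs => rw [← h]
      rw [Submodule.smul_sup, ← Submodule.mul_smul, ← Submodule.pow_succ]
      exact sup_le_sup_right Submodule.smul_le_right _
  simpa [ht] using key t

/-- Induction on $s$ makes the chain stationary up to $J^sM$. In the step, $N_n/JN_n$ is finitely
generated semisimple, hence Artinian, so the traces of the chain on it stabilize. -/
theorem Submodule.exists_forall_ge_eq_of_antitone_of_fg [J.IsTwoSided]
    [IsSemisimpleRing (R ⧸ J)]
    (hJ : IsNilpotent J) {M : Type*} [AddCommGroup M] [Module R M] {N : ℕ → Submodule R M}
    (hN : Antitone N) (hfg : ∀ i, (N i).FG) : ∃ n, ∀ m, n ≤ m → N n = N m := by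
  obtain ⟨t, ht⟩ := hJ
  have key : ∀ s : ℕ, ∃ n, ∀ m, n ≤ m → N n ≤ N m ⊔ J ^ s • ⊤ := by
    intro s
    induction s with
    | zero => exact ⟨0, by simp [Submodule.pow_zero]⟩
    | succ s ih =>
      obtain ⟨n, hn⟩ := ih
      have := J.isSemisimpleModule_quotient_smul_top (N n)
      have : Module.Finite R (N n) := Module.Finite.iff_fg.mpr (hfg n)
      have : IsArtinian R (N n ⧸ (J • ⊤ : Submodule R (N n))) :=
        by
          have := IsSemisimpleModule.finite_tfae (R := R) (M := N n ⧸ (J • ⊤ : Submodule R (N n)))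
          exact (this.out 0 2).mp (inferInstance : Module.Finite R _)
      let f : ℕ →o (Submodule R (N n ⧸ (J • ⊤ : Submodule R (N n))))ᵒᵈ :=
        ⟨fun i ↦ OrderDual.toDual (((N (n + i)).comap (N n).subtype).map
          (J • ⊤ : Submodule R (N n)).mkQ),
          fun i j hij ↦ Submodule.map_mono (Submodule.comap_mono (hN (by lia)))⟩
      obtain ⟨m, hm⟩ := IsArtinian.monotone_stabilizes f
      refine ⟨n + m, fun i hi x hx ↦ ?_⟩
      have hxn : x ∈ N n := hN (by lia) hx
      have h1 : (J • ⊤ : Submodule R (N n)).mkQ ⟨x, hxn⟩ ∈ OrderDual.ofDual (f m) :=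
        Submodule.mem_map_of_mem hx
      rw [hm (i - n) (by lia)] at h1
      obtain ⟨y, hy, hxy⟩ := h1
      have hy : y.1 ∈ N i := by simpa [show n + (i - n) = i by lia] using hy
      have h2 : y - ⟨x, hxn⟩ ∈ (J • ⊤ : Submodule R (N n)) := (Submodule.Quotient.eq _).mp hxy
      have h3 := Submodule.mem_map_of_mem (f := (N n).subtype) h2
      rw [Submodule.map_smul'', Submodule.map_top, Submodule.range_subtype] at h3
      -- Multiplying the previous inclusion by $J$ raises the exponent by one.
      have h4 : J • N n ≤ N i ⊔ J ^ (s + 1) • ⊤ := by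
        refine (smul_mono_right J (hn i (by lia))).trans ?_
        rw [Submodule.smul_sup, ← Submodule.mul_smul, ← Ideal.IsTwoSided.pow_succ]
        exact sup_le_sup_right Submodule.smul_le_right _
      have h5 := h4 h3
      rw [map_sub] at h5
      have := sub_mem (Submodule.mem_sup_left hy : y.1 ∈ N i ⊔ J ^ (s + 1) • ⊤) h5
      simpa using this
  obtain ⟨n, hn⟩ := key t
  refine ⟨n, fun m hm ↦ le_antisymm ?_ (hN hm)⟩
  simpa [ht] using hn m hm

theorem Submodule.exists_minimal_of_fg [J.IsTwoSided] [IsSemisimpleRing (R ⧸ J)]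
    (hJ : IsNilpotent J) {M : Type*} [AddCommGroup M] [Module R M] {S : Set (Submodule R M)}
    (hS : S.Nonempty) (hfg : ∀ N ∈ S, N.FG) : ∃ N ∈ S, ∀ N' ∈ S, N' ≤ N → N' = N := by
  by_contra! h
  choose! f hf hle hne using h
  obtain ⟨N, hN⟩ := hS
  have hmem (i : ℕ) : f^[i] N ∈ S := by
    induction i with
    | zero => exact hN
    | succ i ih => rw [Function.iterate_succ_apply']; exact hf _ ih
  obtain ⟨n, hn⟩ := Submodule.exists_forall_ge_eq_of_antitone_of_fg (N := fun i ↦ f^[i] N) hJ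
    (antitone_nat_of_succ_le fun i ↦ by
      rw [Function.iterate_succ_apply']; exact hle _ (hmem i)) fun i ↦ hfg _ (hmem i)
  refine hne _ (hmem n) ?_
  rw [← Function.iterate_succ_apply' f]
  exact (hn (n + 1) n.le_succ).symm

/-- Modulo $JM$, a surjective endomorphism of a Noetherian module is injective, so $gf\equiv 1$. The
defect $d=1-gf$ is idempotent with image in $JM$, so its image lies in every $J^sM$. -/
theorem LinearMap.comp_eq_id_of_isNilpotent_of_finite [J.IsTwoSided]
    [IsSemisimpleRing (R ⧸ J)]
    (hJ : IsNilpotent J) {M : Type*} [AddCommGroup M] [Module R M] [Module.Finite R M]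
    {f g : M →ₗ[R] M} (h : f ∘ₗ g = LinearMap.id) : g ∘ₗ f = LinearMap.id := by
  obtain ⟨t, ht⟩ := hJ
  have := J.isSemisimpleModule_quotient_smul_top M
  have hle (f : M →ₗ[R] M) (K : Submodule R M) (I : Ideal R) (hK : K ≤ I • ⊤) :
      K.map f ≤ I • ⊤ := by
    refine (Submodule.map_mono hK).trans ?_
    rw [Submodule.map_smul'']
    exact smul_mono_right _ le_top
  let P : Submodule R M := J • ⊤
  have hP (f : M →ₗ[R] M) : P ≤ P.comap f := Submodule.map_le_iff_le_comap.mp (hle f _ _ le_rfl)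
  let f' := P.mapQ P f (hP f)
  let g' := P.mapQ P g (hP g)
  have hfg' : f' ∘ₗ g' = LinearMap.id := by
    ext x
    simpa [f', g'] using congr(P.mkQ ($h x))
  have hgf' : g' ∘ₗ f' = LinearMap.id := by
    have hs : Function.Surjective f' := fun x ↦ ⟨g' x, congr($hfg' x)⟩
    have hi := IsNoetherian.injective_of_surjective_endomorphism f' hs
    ext x
    apply hi
    exact congr($hfg' (f' (P.mkQ x)))
  let d : M →ₗ[R] M := LinearMap.id - g ∘ₗ f
  have hd : d ∘ₗ d = d := by
    ext x
    have := congr($h (f x))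
    simp only [LinearMap.comp_apply, LinearMap.id_apply] at this
    simp [d, this]
  have key : ∀ s : ℕ, LinearMap.range d ≤ J ^ s • ⊤ := by
    intro s
    induction s with
    | zero => simp [Submodule.pow_zero]
    | succ s ih =>
      have h1 : LinearMap.range d ≤ J • ⊤ := by
        rintro _ ⟨x, rfl⟩
        rw [← Submodule.Quotient.mk_eq_zero]
        have h1 : P.mkQ (g (f x)) = P.mkQ x := congr($hgf' (P.mkQ x))
        simpa [d, sub_eq_zero] using h1.symm
      have h2 : LinearMap.range d ≤ J • LinearMap.range d := by
        conv_lhs => rw [← hd, LinearMap.range_comp]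
        refine (Submodule.map_mono h1).trans ?_
        rw [Submodule.map_smul'', Submodule.map_top]
      refine h2.trans ((smul_mono_right J ih).trans ?_)
      rw [← Submodule.mul_smul, ← Ideal.IsTwoSided.pow_succ]
  have := key t
  rw [ht, Submodule.zero_eq_bot, Submodule.bot_smul, le_bot_iff, LinearMap.range_eq_bot] at this
  exact (sub_eq_zero.mp this).symm

theorem IsStablyFiniteRing.of_surjective_of_isNilpotent [J.IsTwoSided]
    [IsSemisimpleRing (R ⧸ J)]
    (hJ : IsNilpotent J) {B : Type*} [Ring B] (φ : R →+* B) (hφ : Function.Surjective φ) :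
    IsStablyFiniteRing B where
  isDedekindFiniteMonoid n := by
    let _ := Module.compHom B φ
    have hsm (r : R) (b : B) : r • b = φ r * b := rfl
    have : Module.Finite R B := by
      refine ⟨⟨{1}, ?_⟩⟩
      rw [eq_top_iff]
      intro b _
      obtain ⟨r, rfl⟩ := hφ b
      refine Submodule.mem_span.mpr fun p hp ↦ ?_
      have := p.smul_mem r (hp (by simp : (1 : B) ∈ _))
      rwa [hsm, mul_one] at this
    let F (X : Matrix (Fin n) (Fin n) B) : (Fin n → B) →ₗ[R] (Fin n → B) :=
      { toFun := fun v ↦ Matrix.vecMul v X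
        map_add' := fun v w ↦ Matrix.add_vecMul X v w
        map_smul' := fun r v ↦ by
          ext i
          simp [Matrix.vecMul, dotProduct, hsm, Finset.mul_sum, mul_assoc] }
    refine ⟨fun {X Y} h ↦ ?_⟩
    -- Row vectors keep the action $R$-linear; right multiplication reverses the order of products.
    have h1 : F Y ∘ₗ F X = LinearMap.id := by
      refine LinearMap.ext fun v ↦ ?_
      simp [F, Matrix.vecMul_vecMul, h]
    have h2 := LinearMap.comp_eq_id_of_isNilpotent_of_finite hJ h1
    ext i j
    have h3 : Matrix.vecMul (Matrix.vecMul (Pi.single i 1) Y) X j =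
      (Pi.single i 1 : Fin n → B) j := congr($h2 (Pi.single i 1) j)
    rw [Matrix.vecMul_vecMul, Matrix.single_one_vecMul] at h3
    exact h3.trans (by simp [Pi.single_apply, Matrix.one_apply, eq_comm])

end Semiprimary

/-! ### Generators whose relations lie in a proper ideal. -/

/-- Given finite families of objects of finitely many classes, with each class present in the
first family, suitable multiples of the second embed class by class into multiples of the first,
bijectively for at least one class. -/
theorem exists_embedding_prod_fin_of_classes {ι ι' C : Type*} [Finite ι] [Finite ι'] [Nonempty ι']
    (κ : ι → C) (κ' : ι' → C) (hκ : Function.Surjective κ) :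
    ∃ (l n : ℕ) (σ : ι' × Fin l ↪ ι × Fin n) (c : C), 0 < l ∧ 0 < n ∧
      (∀ x, κ (σ x).1 = κ' x.1) ∧ ∀ y : ι × Fin n, κ y.1 = c → y ∈ Set.range σ := by
  classical
  have := Fintype.ofFinite ι
  have := Fintype.ofFinite ι'
  have : Finite C := Finite.of_surjective κ hκ
  have := Fintype.ofFinite C
  have : Nonempty C := ‹Nonempty ι'›.map κ'
  let b (c : C) : ℕ := Fintype.card {i // κ i = c}
  let x (c : C) : ℕ := Fintype.card {i // κ' i = c}
  have hb (c : C) : 0 < b c := by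
    obtain ⟨i, hi⟩ := hκ c
    exact Fintype.card_pos_iff.mpr ⟨⟨i, hi⟩⟩
  -- Take $c$ maximizing $x_c/b_c$, with $l=b_c$ and $n=x_c$. Then $l\,x_d\le n\,b_d$ for every
  -- class $d$, with equality for $d=c$.
  obtain ⟨c, -, hc⟩ := Finset.exists_max_image Finset.univ (fun c ↦ (x c : ℚ) / b c)
    Finset.univ_nonempty
  have hle (d : C) : x d * b c ≤ b d * x c := by
    have h1 := hc d (Finset.mem_univ _)
    rw [div_le_div_iff₀ (by exact_mod_cast hb d) (by exact_mod_cast hb c)] at h1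
    have h2 : x d * b c ≤ x c * b d := by exact_mod_cast h1
    rwa [mul_comm (x c)] at h2
  have hx : 0 < x c := by
    obtain ⟨i⟩ := ‹Nonempty ι'›
    have h1 : 0 < x (κ' i) := Fintype.card_pos_iff.mpr ⟨⟨i, rfl⟩⟩
    exact Nat.pos_of_mul_pos_left ((Nat.mul_pos h1 (hb c)).trans_le (hle (κ' i)))
  have hemb (d : C) :
      Nonempty ({i // κ' i = d} × Fin (b c) ↪ {i // κ i = d} × Fin (x c)) := by
    refine Function.Embedding.nonempty_of_card_le ?_
    simpa using hle d
  let τ (d : C) := (hemb d).some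
  have hτ : Function.Surjective (τ c) :=
    ((Fintype.bijective_iff_injective_and_card (τ c)).mpr
      ⟨(τ c).injective, by simp [b, x, mul_comm]⟩).surjective
  let σ (p : ι' × Fin (b c)) : ι × Fin (x c) :=
    ((τ (κ' p.1) (⟨p.1, rfl⟩, p.2)).1.1, (τ (κ' p.1) (⟨p.1, rfl⟩, p.2)).2)
  have hσ (d : C) (i : ι') (h : κ' i = d) (t : Fin (b c)) :
      σ (i, t) = ((τ d (⟨i, h⟩, t)).1.1, (τ d (⟨i, h⟩, t)).2) := by
    subst h; rfl
  have hκσ (p : ι' × Fin (b c)) : κ (σ p).1 = κ' p.1 := (τ (κ' p.1) (⟨p.1, rfl⟩, p.2)).1.2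
  refine ⟨b c, x c, ⟨σ, ?_⟩, c, hb c, hx, hκσ, ?_⟩
  · rintro ⟨i, t⟩ ⟨j, u⟩ h
    have hij : κ' i = κ' j := by
      rw [← hκσ (i, t), ← hκσ (j, u), h]
    rw [hσ _ i hij, hσ _ j rfl] at h
    have h1 : τ (κ' j) (⟨i, hij⟩, t) = τ (κ' j) (⟨j, rfl⟩, u) :=
      Prod.ext (Subtype.ext (Prod.ext_iff.mp h).1) (Prod.ext_iff.mp h).2
    simpa using (τ (κ' j)).injective h1
  · rintro ⟨i, t⟩ hi
    obtain ⟨⟨⟨j, hj⟩, u⟩, hu⟩ := hτ (⟨i, hi⟩, t)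
    refine ⟨(j, u), ?_⟩
    exact (hσ c j hj u).trans (by rw [hu])

theorem Function.Embedding.exists_dependent_extension {α β : Type*} (σ : α ↪ β) {S : β → Type*}
    [∀ b, Zero (S b)] (f : ∀ a, S (σ a)) : ∃ F : ∀ b, S b, ∀ a, F (σ a) = f a := by
  classical
  refine ⟨fun b ↦ if h : ∃ a, σ a = b then h.choose_spec ▸ f h.choose else 0, fun a ↦ ?_⟩
  have h : ∃ a', σ a' = σ a := ⟨a, rfl⟩
  have key (a' : α) (h' : σ a' = σ a) : (h' ▸ f a' : S (σ a)) = f a := by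
    obtain rfl := σ.injective h'
    rfl
  simp only [h, ↓reduceDIte]
  exact key _ _

theorem IsSimpleModule.nonempty_linearEquiv_of_ne_zero {R M N : Type*} [Ring R] [AddCommGroup M]
    [AddCommGroup N] [Module R M] [Module R N] [IsSimpleModule R M] [IsSimpleModule R N]
    {f : M →ₗ[R] N} (hf : f ≠ 0) : Nonempty (M ≃ₗ[R] N) :=
  ⟨LinearEquiv.ofBijective f (LinearMap.bijective_of_ne_zero hf)⟩

theorem LinearMap.apply_eq_zero_of_forall_single {R ι B T : Type*} [Ring R] [Finite ι]
    [DecidableEq ι] {S : ι → Type*} [∀ i, AddCommGroup (S i)] [∀ i, Module R (S i)]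
    [AddCommGroup B] [Module R B] [AddCommGroup T] [Module R T]
    (e : B ≃ₗ[R] ∀ i, S i) (f : B →ₗ[R] T) (b : B)
    (h : ∀ i, e b i = 0 ∨ f ∘ₗ e.symm.toLinearMap ∘ₗ LinearMap.single R S i = 0) : f b = 0 := by
  have := Fintype.ofFinite ι
  have h1 : f b = ∑ i, (f ∘ₗ e.symm.toLinearMap ∘ₗ LinearMap.single R S i) (e b i) := by
    simp only [LinearMap.comp_apply, LinearEquiv.coe_coe, LinearMap.coe_single, ← map_sum]
    rw [Finset.univ_sum_single, e.symm_apply_apply]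
  rw [h1]
  refine Finset.sum_eq_zero fun i _ ↦ ?_
  rcases h i with h | h
  · rw [h, map_zero]
  · rw [h, LinearMap.zero_apply]

/-- Over a ring that is semisimple modulo a nilpotent ideal `J`, some power `Nˡ` of a nonzero
finitely generated module has a finite generating family all of whose relations have their
coefficients in a fixed proper two-sided ideal. -/
theorem Module.Finite.exists_span_eq_top_relations_mem {R : Type*} [Ring R] {J : Ideal R}
    [J.IsTwoSided] [IsSemisimpleRing (R ⧸ J)] (hJ : IsNilpotent J) (N : Type*) [AddCommGroup N]
    [Module R N] [Module.Finite R N] [Nontrivial N] :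
    ∃ (l n : ℕ) (e : Fin n → Fin l → N) (S : TwoSidedIdeal R), 0 < l ∧ 0 < n ∧ S ≠ ⊤ ∧
      Submodule.span R (Set.range e) = ⊤ ∧
      ∀ q : Fin n → R, ∑ j, q j • e j = 0 → ∀ j, q j ∈ S := by
  classical
  let P : Submodule R N := J • ⊤
  let X := N ⧸ P
  have hBJ : ∀ r ∈ J, ∀ b : R ⧸ J, r • b = 0 := by
    intro r hr b
    obtain ⟨b, rfl⟩ := Ideal.Quotient.mk_surjective b
    exact Ideal.Quotient.eq_zero_iff_mem.mpr (J.mul_mem_right b hr)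
  have hXJ : ∀ r ∈ J, ∀ x : X, r • x = 0 := by
    intro r hr x
    obtain ⟨x, rfl⟩ := P.mkQ_surjective x
    exact (Submodule.Quotient.mk_eq_zero _).mpr (Submodule.smul_mem_smul hr Submodule.mem_top)
  have : IsSemisimpleModule R X := J.isSemisimpleModule_quotient_smul_top N
  have : IsSemisimpleModule R (R ⧸ J) := J.isSemisimpleModule_of_smul_eq_zero hBJ
  obtain ⟨a, S, eB₀, hS⟩ := IsSemisimpleModule.exists_linearEquiv_fin_dfinsupp R (R ⧸ J)
  obtain ⟨a', S', eX₀, hS'⟩ := IsSemisimpleModule.exists_linearEquiv_fin_dfinsupp R X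
  let eB : (R ⧸ J) ≃ₗ[R] ∀ i, S i := eB₀ ≪≫ₗ DFinsupp.linearEquivFunOnFintype
  let eX : X ≃ₗ[R] ∀ i, S' i := eX₀ ≪≫ₗ DFinsupp.linearEquivFunOnFintype
  have hX : Nontrivial X := by
    refine Submodule.Quotient.nontrivial_iff.mpr fun h ↦ ?_
    have h1 : (⊥ : Submodule R N) = ⊤ :=
      Submodule.eq_top_of_sup_smul_top_eq_top hJ (by rw [bot_sup_eq]; exact h)
    exact bot_ne_top h1
  have : Nonempty (Fin a') := by
    by_contra h
    rw [not_nonempty_iff] at h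
    have := eX.toEquiv.subsingleton
    exact not_subsingleton X this
  let st : Setoid (Fin a) :=
    ⟨fun i j ↦ Nonempty (S i ≃ₗ[R] S j), ⟨fun i ↦ ⟨LinearEquiv.refl R _⟩,
      fun ⟨e⟩ ↦ ⟨e.symm⟩, fun ⟨e⟩ ⟨f⟩ ↦ ⟨e ≪≫ₗ f⟩⟩⟩
  -- A simple constituent of $X$ is killed by $J$, hence is a quotient of $R/J$ and isomorphic to
  -- one of its constituents.
  have hex (i' : Fin a') : ∃ i, Nonempty (S i ≃ₗ[R] S' i') := by
    have := IsSimpleModule.nontrivial R (S' i')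
    obtain ⟨x, hx⟩ := exists_ne (0 : S' i')
    have hxJ : J ≤ LinearMap.ker (LinearMap.toSpanSingleton R (S' i') x) := by
      intro r hr
      rw [LinearMap.mem_ker, LinearMap.toSpanSingleton_apply]
      exact Subtype.ext (hXJ r hr x)
    let f : (R ⧸ J) →ₗ[R] S' i' := Submodule.liftQ J _ hxJ
    have hf : f (Ideal.Quotient.mk J 1) = x := by
      exact (Submodule.liftQ_apply J _ 1).trans (one_smul R x)
    by_contra hcon
    refine hx (hf ▸ LinearMap.apply_eq_zero_of_forall_single eB f _ fun i ↦ Or.inr ?_)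
    by_contra h0
    exact hcon ⟨i, IsSimpleModule.nonempty_linearEquiv_of_ne_zero h0⟩
  choose ρ hρ using hex
  -- The embedding turns $X^l$ into a quotient of $(R/J)^n$. As it hits every constituent of class
  -- $c$, the kernel has no component of that class.
  obtain ⟨l, n, σ, c, hl, hn, hσ, hc⟩ := exists_embedding_prod_fin_of_classes
    (Quotient.mk st) (fun i' ↦ Quotient.mk st (ρ i')) Quotient.mk_surjective
  have hτ (x : Fin a' × Fin l) : Nonempty (S (σ x).1 ≃ₗ[R] S' x.1) := by
    obtain ⟨e⟩ := Quotient.exact (hσ x)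
    obtain ⟨f⟩ := hρ x.1
    exact ⟨e ≪≫ₗ f⟩
  let τ (x : Fin a' × Fin l) := (hτ x).some
  let g : (Fin n → R ⧸ J) →ₗ[R] (Fin l → X) := LinearMap.pi fun t ↦
    eX.symm.toLinearMap ∘ₗ LinearMap.pi fun i' ↦ (τ (i', t)).toLinearMap ∘ₗ
      LinearMap.proj (σ (i', t)).1 ∘ₗ eB.toLinearMap ∘ₗ LinearMap.proj (σ (i', t)).2
  have hg (b : Fin n → R ⧸ J) (i' : Fin a') (t : Fin l) :
      eX (g b t) i' = τ (i', t) (eB (b (σ (i', t)).2) (σ (i', t)).1) := by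
    simp [g]
  have hgs : Function.Surjective g := by
    intro x
    obtain ⟨F, hF⟩ := σ.exists_dependent_extension (S := fun p ↦ S p.1)
      (fun p ↦ (τ p).symm (eX (x p.2) p.1))
    refine ⟨fun s ↦ eB.symm fun i ↦ F (i, s), ?_⟩
    ext1 t
    apply eX.injective
    ext1 i'
    rw [hg]
    have := hF (i', t)
    simp only [LinearEquiv.apply_symm_apply]
    rw [show F ((σ (i', t)).1, (σ (i', t)).2) = F (σ (i', t)) from rfl, this]
    simp
  let π : (Fin l → N) →ₗ[R] (Fin l → X) := LinearMap.pi fun t ↦ P.mkQ ∘ₗ LinearMap.proj t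
  have hπs : Function.Surjective π := by
    intro x
    choose y hy using fun t ↦ P.mkQ_surjective (x t)
    exact ⟨y, funext hy⟩
  have hπ (y : Fin l → N) (hy : π y = 0) : y ∈ J • (⊤ : Submodule R (Fin l → N)) := by
    rw [← Finset.univ_sum_single y]
    refine Submodule.sum_mem _ fun t _ ↦ ?_
    have h1 : y t ∈ P := (Submodule.Quotient.mk_eq_zero _).mp congr($hy t)
    have h2 := Submodule.mem_map_of_mem (f := LinearMap.single R (fun _ : Fin l ↦ N) t) h1
    rw [Submodule.map_smul''] at h2
    exact Submodule.smul_mono le_rfl le_top h2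
  choose e he using fun j : Fin n ↦ hπs (g (Pi.single j 1))
  have heg (q : Fin n → R) : π (∑ j, q j • e j) = g fun j ↦ Ideal.Quotient.mk J (q j) := by
    have h1 (j : Fin n) : q j • (Pi.single j 1 : Fin n → R ⧸ J) =
        Pi.single j (Ideal.Quotient.mk J (q j)) := by
      rw [← Pi.single_smul]
      exact congrArg _ (congrArg (Ideal.Quotient.mk J) (mul_one (q j)))
    simp only [map_sum, map_smul, he, ← map_smul g, h1]
    rw [← map_sum, Finset.univ_sum_single]
  obtain ⟨i₀, rfl⟩ := Quotient.mk_surjective c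
  refine ⟨l, n, e, (Module.annihilator R (S i₀)).toTwoSided, hl, hn, ?_, ?_, ?_⟩
  · intro h
    have h1 := (TwoSidedIdeal.one_mem_iff _).mpr h
    rw [Ideal.mem_toTwoSided, Module.mem_annihilator] at h1
    have := IsSimpleModule.nontrivial R (S i₀)
    obtain ⟨x, hx⟩ := exists_ne (0 : S i₀)
    exact hx (by simpa using h1 x)
  · apply Submodule.eq_top_of_sup_smul_top_eq_top hJ
    rw [eq_top_iff]
    intro y _
    obtain ⟨b, hb⟩ := hgs (π y)
    choose q hq using fun j ↦ Ideal.Quotient.mk_surjective (b j)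
    obtain rfl : (fun j ↦ Ideal.Quotient.mk J (q j)) = b := funext hq
    rw [← heg, ← sub_eq_zero, ← map_sub] at hb
    have h1 : ∑ j, q j • e j ∈ Submodule.span R (Set.range e) :=
      Submodule.sum_mem _ fun j _ ↦ Submodule.smul_mem _ _ (Submodule.subset_span ⟨j, rfl⟩)
    have h2 := sub_mem (Submodule.mem_sup_left h1) (Submodule.mem_sup_right (hπ _ hb))
    simpa using h2
  · intro q hq s
    have h1 : g (fun j ↦ Ideal.Quotient.mk J (q j)) = 0 := by rw [← heg, hq, map_zero]
    have h2 (i : Fin a) (hi : Quotient.mk st i = Quotient.mk st i₀) :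
        eB (Ideal.Quotient.mk J (q s)) i = 0 := by
      obtain ⟨⟨i', t⟩, hp⟩ := hc (i, s) hi
      have h3 := hg (fun j ↦ Ideal.Quotient.mk J (q j)) i' t
      have h4 : eB (Ideal.Quotient.mk J (q (σ (i', t)).2)) (σ (i', t)).1 = 0 := by
        rw [h1] at h3
        apply (τ (i', t)).injective
        rw [← h3, map_zero, Pi.zero_apply, map_zero, Pi.zero_apply]
      rwa [hp] at h4
    rw [Ideal.mem_toTwoSided, Module.mem_annihilator]
    intro v
    have hvJ : J ≤ LinearMap.ker (LinearMap.toSpanSingleton R (S i₀) v) := by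
      intro r hr
      rw [LinearMap.mem_ker, LinearMap.toSpanSingleton_apply]
      exact Subtype.ext (hBJ r hr v)
    let f : (R ⧸ J) →ₗ[R] S i₀ := Submodule.liftQ J _ hvJ
    have hf : f (Ideal.Quotient.mk J (q s)) = q s • v := Submodule.liftQ_apply J _ (q s)
    rw [← hf]
    -- Coordinates of class $c$ vanish; constituents of other classes have no nonzero map to `S i₀`.
    refine LinearMap.apply_eq_zero_of_forall_single eB f _ fun i ↦ ?_
    by_cases hi : Quotient.mk st i = Quotient.mk st i₀
    · exact Or.inl (h2 i hi)
    · refine Or.inr ?_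
      by_contra h0
      exact hi (Quotient.sound (IsSimpleModule.nonempty_linearEquiv_of_ne_zero h0))

/-! ### Finiteness of coalgebras and stable finiteness of convolution algebras. -/

section Comatrix

open Coalgebra (comul counit)
open scoped TensorProduct

variable {k C : Type*} [Field k] [AddCommGroup C] [Module k C] [Coalgebra k C]

/-- Every element `h` of a coalgebra over a field lies in a finite-dimensional left coideal. -/
theorem Coalgebra.exists_leftCoideal_basis (h : C) :
    ∃ (d : ℕ) (w : Fin d → C) (c : Fin d → Fin d → C), LinearIndependent k w ∧
      h ∈ Submodule.span k (Set.range w) ∧ ∀ j, comul (R := k) (w j) = ∑ i, w i ⊗ₜ[k] c i j := by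
  classical
  let b := Module.Basis.ofVectorSpace k C
  let x := TensorProduct.equivFinsuppOfBasisRight b (comul (R := k) h)
  have hx : comul (R := k) h = ∑ i ∈ x.support, x i ⊗ₜ[k] b i := by
    have h1 := (TensorProduct.equivFinsuppOfBasisRight b).symm_apply_apply (comul (R := k) h)
    rw [← h1, TensorProduct.equivFinsuppOfBasisRight_symm_apply]
    rfl
  let slice (i) : C ⊗[k] C →ₗ[k] C :=
    (_root_.TensorProduct.rid k C).toLinearMap ∘ₗ (b.coord i).lTensor C
  have hassoc (i) (t : C ⊗[k] C) (c : C) :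
      (slice i).lTensor C (_root_.TensorProduct.assoc k C C C (t ⊗ₜ c)) = b.coord i c • t := by
    induction t with
    | zero => simp
    | add s t hs ht => rw [TensorProduct.add_tmul, map_add, map_add, hs, ht, smul_add]
    | tmul s t => simp [slice, TensorProduct.tmul_smul]
  -- Applying the $i$-th coordinate to the last factor of coassociativity shows that the span of the
  -- left tensor factors $x_i$ of $\Delta h$ is a left coideal.
  have hcomul (i) (hi : i ∈ x.support) :
      comul (R := k) (x i) = ∑ j ∈ x.support, x j ⊗ₜ[k] slice i (comul (R := k) (b j)) := by
    have h1 := congrArg ((slice i).lTensor C) (Coalgebra.coassoc_apply (R := k) h)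
    rw [hx] at h1
    simp only [map_sum, LinearMap.rTensor_tmul, LinearMap.lTensor_tmul, hassoc] at h1
    rw [← h1, Finset.sum_eq_single_of_mem i hi]
    · simp
    · intro j _ hj
      simp [hj]
  let W := Submodule.span k (x '' x.support)
  have hxW (i) (hi : i ∈ x.support) : x i ∈ W := Submodule.subset_span ⟨i, hi, rfl⟩
  have : FiniteDimensional k W := FiniteDimensional.span_of_finite k
    ((Finset.finite_toSet x.support).image x)
  let w := Module.finBasis k W
  have hspan : Submodule.span k (Set.range fun i ↦ (w i : C)) = W := by
    have h1 := congrArg (Submodule.map W.subtype) w.span_eq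
    rw [Submodule.map_span, Submodule.map_top, Submodule.range_subtype, ← Set.range_comp] at h1
    exact h1
  let E : Submodule k C :=
    { carrier := {v | ∃ c : Fin _ → C, comul (R := k) v = ∑ i, (w i : C) ⊗ₜ[k] c i}
      zero_mem' := ⟨0, by simp⟩
      add_mem' := by
        rintro u v ⟨c, hc⟩ ⟨d, hd⟩
        exact ⟨c + d, by simp [hc, hd, TensorProduct.tmul_add, Finset.sum_add_distrib]⟩
      smul_mem' := by
        rintro a v ⟨c, hc⟩
        exact ⟨a • c, by simp [hc, TensorProduct.tmul_smul, Finset.smul_sum]⟩ }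
  have hE : W ≤ E := by
    refine Submodule.span_le.mpr ?_
    rintro _ ⟨i, hi, rfl⟩
    refine ⟨fun l ↦ ∑ j ∈ x.support.attach,
      w.repr ⟨x j, hxW j j.2⟩ l • slice i (comul (R := k) (b j)), ?_⟩
    rw [hcomul i hi]
    simp only [TensorProduct.tmul_sum]
    rw [Finset.sum_comm, ← Finset.sum_attach]
    refine Finset.sum_congr rfl fun j _ ↦ ?_
    simp only [← TensorProduct.smul_tmul, ← TensorProduct.sum_tmul]
    congr 1
    have h1 := congrArg W.subtype (w.sum_repr ⟨x j, hxW j j.2⟩)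
    rw [map_sum] at h1
    exact h1.symm
  choose c hc using fun j ↦ hE (w j).2
  refine ⟨_, fun i ↦ w i, fun i j ↦ c j i, ?_, ?_, hc⟩
  · exact w.linearIndependent.map' W.subtype (Submodule.ker_subtype W)
  · rw [hspan]
    have h1 := Coalgebra.lTensor_counit_comul (R := k) h
    rw [hx] at h1
    simp only [map_sum, LinearMap.lTensor_tmul] at h1
    have h2 := congrArg (_root_.TensorProduct.rid k C) h1
    simp only [map_sum, _root_.TensorProduct.rid_tmul, one_smul] at h2
    rw [← h2]
    exact Submodule.sum_mem _ fun i hi ↦ W.smul_mem _ (hxW i hi)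

/-- Every element of a coalgebra over a field is a linear combination of the entries of a matrix
`c` with `Δ cᵢⱼ = ∑ cᵢₗ ⊗ cₗⱼ` and `ε(cᵢⱼ) = δᵢⱼ`. -/
theorem Coalgebra.exists_comatrix (h : C) :
    ∃ (d : ℕ) (c : Fin d → Fin d → C),
      (∀ i j, comul (R := k) (c i j) = ∑ l, c i l ⊗ₜ[k] c l j) ∧
      (∀ i j, counit (R := k) (c i j) = if i = j then 1 else 0) ∧
      h ∈ Submodule.span k (Set.range fun p : Fin d × Fin d ↦ c p.1 p.2) := by
  obtain ⟨d, w, c, hw, hh, hc⟩ := Coalgebra.exists_leftCoideal_basis (k := k) h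
  -- Dual functionals extract the coefficients of $w_i$ from the coassociativity and counit
  -- identities for $w_j$.
  have hψ (i : Fin d) : ∃ ψ : C →ₗ[k] k, ∀ j, ψ (w j) = if j = i then 1 else 0 := by
    let B := Module.Basis.span hw
    obtain ⟨ψ, hψ⟩ := (B.coord i).exists_extend
    refine ⟨ψ, fun j ↦ ?_⟩
    have h1 : ψ (w j) = B.coord i (B j) := by
      rw [← hψ]
      simp [B, Module.Basis.span_apply]
    rw [h1, Module.Basis.coord_apply, Module.Basis.repr_self, Finsupp.single_apply]
  choose ψ hψ using hψ
  refine ⟨d, c, fun i j ↦ ?_, fun i j ↦ ?_, ?_⟩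
  · have h1 := congrArg (fun t ↦ _root_.TensorProduct.lid k _ ((ψ i).rTensor (C ⊗[k] C) t))
      (Coalgebra.coassoc_apply (R := k) (w j))
    simp only [hc, map_sum, LinearMap.rTensor_tmul, LinearMap.lTensor_tmul,
      TensorProduct.sum_tmul, _root_.TensorProduct.assoc_tmul, hψ, _root_.TensorProduct.lid_tmul,
      ite_smul, one_smul, zero_smul, Finset.sum_ite_eq', Finset.mem_univ, if_true] at h1
    exact h1.symm
  · have h1 := congrArg (fun t ↦ ψ i (_root_.TensorProduct.rid k C t))
      (Coalgebra.lTensor_counit_comul (R := k) (w j))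
    simp only [hc, map_sum, LinearMap.lTensor_tmul, _root_.TensorProduct.rid_tmul, map_smul, hψ,
      smul_eq_mul, mul_ite, mul_one, mul_zero, Finset.sum_ite_eq', Finset.mem_univ, if_true,
      one_smul] at h1
    rw [h1]
    simp [eq_comm]
  · refine (Submodule.span_le.mpr ?_ : Submodule.span k (Set.range w) ≤ _) hh
    rintro _ ⟨j, rfl⟩
    have h1 := congrArg (_root_.TensorProduct.lid k C) (Coalgebra.rTensor_counit_comul (R := k) (w j))
    simp only [hc, map_sum, LinearMap.rTensor_tmul, _root_.TensorProduct.lid_tmul, one_smul] at h1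
    rw [← h1]
    exact Submodule.sum_mem _ fun i _ ↦ Submodule.smul_mem _ _ (Submodule.subset_span ⟨(i, j), rfl⟩)

/-- Evaluation of the convolution algebra at the entries of a comultiplicative matrix. -/
def WithConv.evalComatrix (B : Type*) [Ring B] [Algebra k B] {d : ℕ} (c : Fin d → Fin d → C)
    (hc : ∀ i j, comul (R := k) (c i j) = ∑ l, c i l ⊗ₜ[k] c l j)
    (hε : ∀ i j, counit (R := k) (c i j) = if i = j then 1 else 0) :
    WithConv (C →ₗ[k] B) →+* Matrix (Fin d) (Fin d) B where
  toFun f := Matrix.of fun i j ↦ f (c i j)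
  map_one' := by
    ext i j
    by_cases h : i = j <;> simp [hε, Matrix.one_apply, h]
  map_mul' f g := by
    ext i j
    simp [hc, Matrix.mul_apply]
  map_zero' := rfl
  map_add' f g := rfl

/-- An equality of convolution matrices is tested at one $x\in C$ at a time. Since $x$ is in the
span of a comatrix, and evaluation there is a ring homomorphism to matrices over $B$, stable
finiteness of $B$ applies. -/
instance WithConv.isStablyFiniteRing (B : Type*) [Ring B] [Algebra k B] [IsStablyFiniteRing B] :
    IsStablyFiniteRing (WithConv (C →ₗ[k] B)) where
  isDedekindFiniteMonoid n := by
    refine ⟨fun {X Y} h ↦ ?_⟩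
    ext a b x
    obtain ⟨d, c, hc, hε, hx⟩ := Coalgebra.exists_comatrix (k := k) x
    let θ := (WithConv.evalComatrix B c hc hε).mapMatrix (m := Fin n)
    have h1 : θ Y * θ X = 1 := mul_eq_one_symm (by rw [← map_mul, h, map_one])
    rw [← map_mul, ← map_one θ] at h1
    have h2 : Set.EqOn ((Y * X) a b).ofConv
        ((1 : Matrix (Fin n) (Fin n) (WithConv (C →ₗ[k] B))) a b).ofConv
        (Set.range fun p : Fin d × Fin d ↦ c p.1 p.2) := by
      rintro _ ⟨p, rfl⟩
      exact congr($h1 a b p.1 p.2)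
    exact LinearMap.eqOn_span h2 hx

end Comatrix

/-! ### Stability under $H$ of the ideal of relation coefficients. -/

section Convolution

open Coalgebra (comul counit)
open MulOpposite (op unop)

variable {k H Q : Type*} [Field k] [Ring H] [HopfAlgebra k H]
  [Ring Q] [Algebra k Q] [Module H Q] [HModuleAlgebra k H Q]

variable (k H Q) in
/-- The algebra map `q ↦ (h ↦ h q)` from an `H`-module algebra to the convolution algebra. -/
def HModuleAlgebra.orbitHom : Q →+* WithConv (H →ₗ[k] Q) where
  toFun q := .toConv ((LinearMap.toSpanSingleton H Q q).restrictScalars k)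
  map_one' := by
    ext h
    simp [HModuleAlgebra.smul_one_eq (k := k)]
  map_mul' a b := by
    ext h
    exact HModuleAlgebra.smul_mul_eq h a b
  map_zero' := by
    ext h
    simp
  map_add' a b := by
    ext h
    simp

theorem HModuleAlgebra.orbitHom_apply (q : Q) (h : H) : orbitHom k H Q q h = h • q := rfl

section

variable {C : Type*} [AddCommGroup C] [Module k C] [Coalgebra k C]

theorem WithConv.toSpanSingleton_comp_counit_mul_apply (q : Q)
    (f : WithConv (C →ₗ[k] Q)) (c : C) :
    ((.toConv (LinearMap.toSpanSingleton k Q q ∘ₗ counit) : WithConv (C →ₗ[k] Q)) * f) c =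
      q * f c := by
  let r := Coalgebra.Repr.arbitrary k c
  rw [r.convMul_apply]
  conv_rhs => rw [← Coalgebra.sum_counit_smul (𝓡 := r)]
  simp [Finset.mul_sum]

variable (k C Q) in
/-- The algebra map `q ↦ (c ↦ ε(c) q)` to the convolution algebra. -/
def WithConv.constHom : Q →+* WithConv (C →ₗ[k] Q) where
  toFun q := .toConv (LinearMap.toSpanSingleton k Q q ∘ₗ counit)
  map_one' := by
    ext c
    simp [Algebra.algebraMap_eq_smul_one]
  map_mul' a b := by
    ext c
    rw [WithConv.toSpanSingleton_comp_counit_mul_apply]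
    simp
  map_zero' := by
    ext c
    simp
  map_add' a b := by
    ext c
    simp

theorem WithConv.constHom_apply (q : Q) (c : C) :
    constHom k Q C q c = counit (R := k) c • q := rfl

theorem WithConv.constHom_mul_apply (q : Q) (f : WithConv (C →ₗ[k] Q)) (c : C) :
    (constHom k Q C q * f) c = q * f c :=
  toSpanSingleton_comp_counit_mul_apply q f c

variable (k C) in
/-- Postcomposition with an algebra homomorphism, on convolution algebras. -/
def WithConv.postcompHom {B : Type*} [Ring B] [Algebra k B] (φ : Q →ₐ[k] B) :
    WithConv (C →ₗ[k] Q) →+* WithConv (C →ₗ[k] B) where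
  toFun f := .toConv (φ.toLinearMap ∘ₗ f.ofConv)
  map_one' := by
    ext c
    simp
  map_mul' f g := by
    ext c
    exact congr($(LinearMap.algHom_comp_convMul_distrib φ f g) c)
  map_zero' := by
    ext c
    simp
  map_add' f g := by
    ext c
    simp

theorem WithConv.postcompHom_apply {B : Type*} [Ring B] [Algebra k B] (φ : Q →ₐ[k] B)
    (f : WithConv (C →ₗ[k] Q)) (c : C) : postcompHom k C φ f c = φ (f c) := rfl

end

/-- The elements whose `H`-orbit lies in the two-sided ideal `I`. -/
def TwoSidedIdeal.stableCore (k : Type*) (H : Type*) {Q : Type*} [Field k] [Ring H]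
    [HopfAlgebra k H] [Ring Q] [Algebra k Q] [Module H Q] [HModuleAlgebra k H Q]
    (I : TwoSidedIdeal Q) : TwoSidedIdeal Q :=
  .mk' {x | ∀ h : H, h • x ∈ I} (by simp [I.zero_mem])
    (fun hx hy h ↦ by rw [smul_add]; exact I.add_mem (hx h) (hy h))
    (fun hx h ↦ by rw [smul_neg]; exact I.neg_mem (hx h))
    (fun hx h ↦ by
      rw [HModuleAlgebra.smul_mul_repr (Coalgebra.Repr.arbitrary k h)]
      exact I.finsetSum_mem _ _ fun i _ ↦ I.mul_mem_left _ _ (hx _))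
    (fun hx h ↦ by
      rw [HModuleAlgebra.smul_mul_repr (Coalgebra.Repr.arbitrary k h)]
      exact I.finsetSum_mem _ _ fun i _ ↦ I.mul_mem_right _ _ (hx _))

theorem TwoSidedIdeal.mem_stableCore {I : TwoSidedIdeal Q} {x : Q} :
    x ∈ I.stableCore k H ↔ ∀ h : H, h • x ∈ I :=
  TwoSidedIdeal.mem_mk' ..

/-- As the core is itself a two-sided ideal, stability need only be checked on ideal generators. -/
theorem TwoSidedIdeal.isHStable_iff_le_stableCore {I : TwoSidedIdeal Q} :
    I.IsHStable H ↔ I ≤ I.stableCore k H :=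
  ⟨fun hI _ hx ↦ mem_stableCore.mpr fun h ↦ hI h _ hx,
    fun hI h _ hx ↦ mem_stableCore.mp (hI hx) h⟩

/-- If the generating families `v` (spanning a finite-dimensional `H`-module) and `e` span the
same right module, and the quotient by the ideal `I` generated by the coefficients of the
relations of `e` is stably finite, then `I` is stable under `H`. -/
theorem TwoSidedIdeal.isHStable_of_span_relations {l n d : Type*} [Fintype l] [Fintype n]
    [Fintype d] [DecidableEq n] {v : Matrix l d Q} {e : Matrix l n Q} {a : Matrix d n Q}
    {b : Matrix n d Q} (he : e = v * a) (hv : v = e * b) {F : d → d → H →ₗ[k] k}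
    (hF : ∀ h i j, h • v i j = ∑ t, F t j h • v i t) {I : TwoSidedIdeal Q}
    (hI : ∀ q : n → Q, e.mulVec q = 0 → ∀ j, q j ∈ I)
    (hIs : I ≤ .span {x | ∃ q : n → Q, e.mulVec q = 0 ∧ ∃ j, q j = x})
    [IsStablyFiniteRing (Q ⧸ I.asIdeal)] : I.IsHStable H := by
  let ι := WithConv.constHom k Q H
  let α := HModuleAlgebra.orbitHom k H Q
  let π := WithConv.postcompHom k H (Ideal.Quotient.mkₐ k I.asIdeal)
  have hπ (f : WithConv (H →ₗ[k] Q)) : π f = 0 ↔ ∀ h, f h ∈ I := by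
    constructor
    · intro hf h
      exact Ideal.Quotient.eq_zero_iff_mem.mp congr($hf h)
    · intro hf
      ext h
      exact Ideal.Quotient.eq_zero_iff_mem.mpr (hf h)
  -- Constants multiply pointwise, so evaluating at $h$ turns a relation over $\mathrm{Hom}(H,Q)$
  -- into one over $Q$.
  have hrel (f : n → WithConv (H →ₗ[k] Q)) (hf : (e.map ι).mulVec f = 0) (j : n) : π (f j) = 0 := by
    rw [hπ]
    intro h
    refine hI (fun j ↦ f j h) (funext fun i ↦ ?_) j
    have h1 : ∑ j, (ι (e i j) * f j) = 0 := congr($hf i)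
    have h2 := congr(WithConv.ofConv $h1 h)
    simp only [WithConv.ofConv_sum, LinearMap.sum_apply] at h2
    simp only [ι, WithConv.constHom_mul_apply] at h2
    exact h2
  let Φ : Matrix d d (WithConv (H →ₗ[k] Q)) :=
    .of fun t j ↦ .toConv (Algebra.linearMap k Q ∘ₗ F t j)
  let Φ' : Matrix d d (WithConv (H →ₗ[k] Q)) :=
    .of fun t j ↦ .toConv (Algebra.linearMap k Q ∘ₗ F t j ∘ₗ HopfAlgebra.antipode k)
  have hΦ : v.map α = v.map ι * Φ := by
    ext i j h
    simp only [Matrix.mul_apply, WithConv.ofConv_sum, LinearMap.sum_apply, Matrix.map_apply]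
    simp only [ι, WithConv.constHom_mul_apply, α, HModuleAlgebra.orbitHom_apply, hF]
    simp [Φ, Algebra.smul_def, Algebra.commutes]
  -- This is $\sum h_{(1)}S(h_{(2)})v=\varepsilon(h)v$, expanded in the family $v$.
  have hΦ' : v.map ι = v.map α * Φ' := by
    ext i j h
    let r := Coalgebra.Repr.arbitrary k h
    simp only [Matrix.mul_apply, WithConv.ofConv_sum, LinearMap.sum_apply, Matrix.map_apply]
    simp only [r.convMul_apply, α, HModuleAlgebra.orbitHom_apply]
    rw [Finset.sum_comm]
    have h1 (p) : ∑ t, r.left p • v i t * Φ' t j (r.right p) =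
        (r.left p * HopfAlgebra.antipode k (r.right p)) • v i j := by
      rw [mul_smul, hF, Finset.smul_sum]
      refine Finset.sum_congr rfl fun t _ ↦ ?_
      rw [smul_comm]
      simp [Φ', Algebra.smul_def, Algebra.commutes]
    rw [Finset.sum_congr rfl fun p _ ↦ h1 p, ← Finset.sum_smul,
      HopfAlgebra.sum_mul_antipode_eq_algebraMap_counit]
    simp [ι, WithConv.constHom_apply]
  let X := b.map ι * Φ * a.map α
  let Y := b.map α * Φ' * a.map ι
  have hX : e.map α = e.map ι * X := by
    rw [he, Matrix.map_mul, hΦ]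
    nth_rw 1 [hv]
    rw [Matrix.map_mul, he]
    simp only [X, Matrix.mul_assoc]
  have hY : e.map ι = e.map α * Y := by
    rw [he, Matrix.map_mul, hΦ']
    nth_rw 1 [hv]
    rw [Matrix.map_mul, he]
    simp only [Y, Matrix.mul_assoc]
  -- The columns of $XY-1$ are relations of $e$, hence vanish modulo $I$.
  have hXY : X.map π * Y.map π = 1 := by
    have h1 : e.map ι * (X * Y - 1) = 0 := by
      rw [Matrix.mul_sub, ← Matrix.mul_assoc, ← hX, ← hY, Matrix.mul_one, sub_self]
    rw [← Matrix.map_mul, ← sub_eq_zero]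
    ext1 i j
    have h2 := hrel (fun i ↦ (X * Y - 1) i j) (funext fun r ↦ congr($h1 r j)) i
    simp only [Matrix.sub_apply, map_sub] at h2
    rw [Matrix.sub_apply, Matrix.map_apply, Matrix.zero_apply, ← h2]
    simp [Matrix.one_apply, apply_ite π]
  -- Stable finiteness of $\mathrm{Hom}(H,Q/I)$ enters here. It allows $X$ to be cancelled from
  -- $X\alpha(q)\equiv 0$ below.
  have hYX : Y.map π * X.map π = 1 := mul_eq_one_symm hXY
  rw [isHStable_iff_le_stableCore (k := k)]
  refine hIs.trans (span_le.mpr ?_)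
  rintro _ ⟨q, hq, j, rfl⟩
  rw [SetLike.mem_coe, mem_stableCore]
  refine (hπ (α (q j))).mp ?_
  have h1 : (e.map α).mulVec (α ∘ q) = 0 := by
    ext1 i
    rw [← RingHom.map_mulVec, hq]
    exact map_zero α
  rw [hX, ← Matrix.mulVec_mulVec] at h1
  have h2 : (X.map π).mulVec (π ∘ α ∘ q) = 0 := by
    ext1 i
    rw [← RingHom.map_mulVec]
    exact hrel _ h1 i
  have h3 := congrArg (Y.map π).mulVec h2
  rw [Matrix.mulVec_mulVec, hYX, Matrix.one_mulVec, Matrix.mulVec_zero] at h3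
  exact congr($h3 j)

end Convolution

/-! ### Stable right ideals as modules over the opposite ring. -/

section RightIdeals

open MulOpposite (op unop)

/-- The radical of $Q$ serves again, since semisimplicity and nilpotency are left-right symmetric.
-/
theorem IsSemiprimaryRing.exists_ideal_mulOpposite (Q : Type*) [Ring Q] [IsSemiprimaryRing Q] :
    ∃ (J : Ideal Qᵐᵒᵖ) (_ : J.IsTwoSided), IsSemisimpleRing (Qᵐᵒᵖ ⧸ J) ∧ IsNilpotent J := by
  let J : Ideal Qᵐᵒᵖ := (Ring.jacobson Q).toTwoSided.op.asIdeal
  have hmem (x : Qᵐᵒᵖ) : x ∈ J ↔ unop x ∈ Ring.jacobson Q := by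
    simp [J, TwoSidedIdeal.mem_op_iff]
  refine ⟨J, inferInstance, ?_, ?_⟩
  · let φ : Q ⧸ Ring.jacobson Q →+* (Qᵐᵒᵖ ⧸ J)ᵐᵒᵖ :=
      Ideal.Quotient.lift _ ((Ideal.Quotient.mk J).op.comp (RingEquiv.opOp Q).toRingHom)
        fun x hx ↦ congrArg op (Ideal.Quotient.eq_zero_iff_mem.mpr ((hmem (op x)).mpr hx))
    have hφ : Function.Surjective φ := by
      intro y
      obtain ⟨x, hx⟩ := Ideal.Quotient.mk_surjective (unop y)
      exact ⟨Ideal.Quotient.mk _ (unop x), congrArg op hx⟩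
    exact isSemisimpleRing_mulOpposite_iff.mp (RingHom.isSemisimpleRing_of_surjective φ hφ)
  · obtain ⟨t, ht⟩ := IsSemiprimaryRing.isNilpotent (R := Q)
    have key (s : ℕ) : ∀ x ∈ J ^ s, unop x ∈ Ring.jacobson Q ^ s := by
      induction s with
      | zero => simp [Submodule.pow_zero]
      | succ s ih =>
        intro x hx
        rw [Submodule.pow_succ] at hx
        rw [Ideal.IsTwoSided.pow_succ]
        induction hx using Submodule.mul_induction_on' with
        | mem_mul_mem a ha b hb => exact Ideal.mul_mem_mul ((hmem b).mp hb) (ih a ha)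
        | add a _ b _ iha ihb => exact add_mem iha ihb
    refine ⟨t, ?_⟩
    rw [Submodule.zero_eq_bot, eq_bot_iff]
    intro x hx
    have := key t x hx
    rw [ht] at this
    exact (MulOpposite.unop_eq_zero_iff x).mp this

theorem Submodule.exists_span_eq_and_smul_eq_sum {k H M : Type*} [Field k] [Ring H] [Algebra k H]
    [AddCommGroup M] [Module k M] [Module H M] [IsScalarTower k H M] (V : Submodule H M)
    [FiniteDimensional k (V.restrictScalars k)] :
    ∃ (d : ℕ) (v : Fin d → M) (F : Fin d → Fin d → H →ₗ[k] k),
      Submodule.span k (Set.range v) = V.restrictScalars k ∧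
      ∀ h j, h • v j = ∑ t, F t j h • v t := by
  let w := Module.finBasis k (V.restrictScalars k)
  refine ⟨_, fun j ↦ w j, fun t j ↦ w.coord t ∘ₗ
    LinearMap.codRestrict (V.restrictScalars k)
      ((LinearMap.toSpanSingleton H M (w j)).restrictScalars k)
      (fun h ↦ V.smul_mem h (w j).2), ?_, fun h j ↦ ?_⟩
  · have h1 := congrArg (Submodule.map (V.restrictScalars k).subtype) w.span_eq
    rw [Submodule.map_span, Submodule.map_top, Submodule.range_subtype, ← Set.range_comp] at h1
    exact h1
  · have h1 := congrArg (V.restrictScalars k).subtype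
      (w.sum_repr ⟨h • (w j : M), V.smul_mem h (w j).2⟩)
    rw [map_sum] at h1
    exact h1.symm

variable {k H Q : Type*} [Field k] [Ring H] [HopfAlgebra k H]
  [Ring Q] [Algebra k Q] [Module H Q] [HModuleAlgebra k H Q]

/-- The two-sided ideal generated by the coefficients of the relations of a family of vectors. -/
def TwoSidedIdeal.relations {ι n : Type*} [Fintype n] (e : n → ι → Q) : TwoSidedIdeal Q :=
  .span {x | ∃ q : n → Q, ∑ j, MulOpposite.op (q j) • e j = 0 ∧ ∃ j, q j = x}

theorem TwoSidedIdeal.mem_relations {ι n : Type*} [Fintype n] {e : n → ι → Q} {q : n → Q}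
    (hq : ∑ j, MulOpposite.op (q j) • e j = 0) (j : n) : q j ∈ relations e :=
  subset_span ⟨q, hq, j, rfl⟩

theorem TwoSidedIdeal.isHStable_relations {l n : ℕ} {e : Fin n → Fin l → Q}
    (V : Submodule H (Fin l → Q)) [FiniteDimensional k (V.restrictScalars k)]
    (he : Submodule.span Qᵐᵒᵖ (Set.range e) = Submodule.span Qᵐᵒᵖ V)
    [IsStablyFiniteRing (Q ⧸ (relations e).asIdeal)] : (relations e).IsHStable H := by
  obtain ⟨d, v, F, hv, hF⟩ := V.exists_span_eq_and_smul_eq_sum (k := k)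
  have hvV : Submodule.span Qᵐᵒᵖ (Set.range v) = Submodule.span Qᵐᵒᵖ V := by
    refine le_antisymm (Submodule.span_mono ?_) (Submodule.span_le.mpr ?_)
    · rintro _ ⟨j, rfl⟩
      have : v j ∈ V.restrictScalars k := hv ▸ Submodule.subset_span ⟨j, rfl⟩
      exact this
    · intro x hx
      have hx : x ∈ V.restrictScalars k := hx
      rw [← hv] at hx
      exact Submodule.span_le_restrictScalars k Qᵐᵒᵖ _ hx
  have h1 (j) : ∃ c : Fin d → Qᵐᵒᵖ, ∑ i, c i • v i = e j := by
    rw [← Submodule.mem_span_range_iff_exists_fun, hvV, ← he]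
    exact Submodule.subset_span ⟨j, rfl⟩
  have h2 (j) : ∃ c : Fin n → Qᵐᵒᵖ, ∑ i, c i • e i = v j := by
    rw [← Submodule.mem_span_range_iff_exists_fun, he, ← hvV]
    exact Submodule.subset_span ⟨j, rfl⟩
  choose a ha using h1
  choose b hb using h2
  have hmul (q : Fin n → Q) (i : Fin l) :
      (Matrix.of fun i j ↦ e j i).mulVec q i = (∑ j, MulOpposite.op (q j) • e j) i := by
    simp [Matrix.mulVec, dotProduct]
  refine TwoSidedIdeal.isHStable_of_span_relations (k := k) (v := .of fun i j ↦ v j i)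
    (e := .of fun i j ↦ e j i) (a := .of fun i j ↦ MulOpposite.unop (a j i))
    (b := .of fun i j ↦ MulOpposite.unop (b j i))
    ?_ ?_ (F := F) ?_ ?_ ?_
  · ext i j
    simp [Matrix.mul_apply, ← ha j]
  · ext i j
    simp [Matrix.mul_apply, ← hb j]
  · intro h i j
    simpa using congr($(hF h j) i)
  · intro q hq j
    exact mem_relations (funext fun i ↦ (hmul q i).symm.trans congr($hq i)) j
  · refine span_mono ?_
    rintro _ ⟨q, hq, j, rfl⟩
    exact ⟨q, funext fun i ↦ (hmul q i).trans congr($hq i), j, rfl⟩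

/-- A right ideal that is stable under the action of `H`. -/
def Submodule.IsHStableRight (H : Type*) {Q : Type*} [Ring H] [Ring Q] [Module H Q]
    (N : Submodule Qᵐᵒᵖ Q) : Prop :=
  ∀ (h : H), ∀ x ∈ N, h • x ∈ N

theorem Submodule.isHStableRight_span (k : Type*) {H Q : Type*} [Field k] [Ring H]
    [HopfAlgebra k H] [Ring Q] [Algebra k Q] [Module H Q] [HModuleAlgebra k H Q] {s : Set Q}
    (hs : ∀ (h : H), ∀ x ∈ s, h • x ∈ Submodule.span Qᵐᵒᵖ s) :
    (Submodule.span Qᵐᵒᵖ s).IsHStableRight H := by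
  intro h x hx
  induction hx using Submodule.span_induction generalizing h with
  | mem x hx => exact hs h x hx
  | zero => simp
  | add x y _ _ ihx ihy => rw [smul_add]; exact add_mem (ihx h) (ihy h)
  | smul q x _ ih =>
    rw [MulOpposite.smul_eq_mul_unop,
      HModuleAlgebra.smul_mul_repr (Coalgebra.Repr.arbitrary k h)]
    exact Submodule.sum_mem _ fun i _ ↦ Submodule.smul_mem _ (MulOpposite.op (_ • _)) (ih _)

/-- The product of a right ideal and a two-sided ideal. -/
def Submodule.mulTwoSided (N : Submodule Qᵐᵒᵖ Q) (I : TwoSidedIdeal Q) : Submodule Qᵐᵒᵖ Q :=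
  Submodule.span Qᵐᵒᵖ {z | ∃ x ∈ N, ∃ y ∈ I, x * y = z}

theorem Submodule.mulTwoSided_le {N : Submodule Qᵐᵒᵖ Q} {I : TwoSidedIdeal Q} :
    N.mulTwoSided I ≤ N := by
  refine Submodule.span_le.mpr ?_
  rintro _ ⟨x, hx, y, -, rfl⟩
  exact N.smul_mem (MulOpposite.op y) hx

theorem Submodule.IsHStableRight.mulTwoSided (k : Type*) {H Q : Type*} [Field k] [Ring H]
    [HopfAlgebra k H] [Ring Q] [Algebra k Q] [Module H Q] [HModuleAlgebra k H Q]
    {N : Submodule Qᵐᵒᵖ Q} (hN : N.IsHStableRight H)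
    {I : TwoSidedIdeal Q} (hI : I.IsHStable H) : (N.mulTwoSided I).IsHStableRight H := by
  refine Submodule.isHStableRight_span k ?_
  rintro h _ ⟨x, hx, y, hy, rfl⟩
  rw [HModuleAlgebra.smul_mul_repr (Coalgebra.Repr.arbitrary k h)]
  exact Submodule.sum_mem _ fun i _ ↦ Submodule.subset_span ⟨_, hN _ _ hx, _, hI _ _ hy, rfl⟩

/-- If $NI=N$, then $N^l=\sum_j e_jI$. Writing $e_j=\sum_i e_iq_i$ with $q_i\in I$ gives a relation
whose $j$-th coefficient is $1-q_j$. -/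
theorem TwoSidedIdeal.exists_mem_one_sub_mem_relations {l n : ℕ} {N : Submodule Qᵐᵒᵖ Q}
    {e : Fin n → Fin l → Q}
    (he : Submodule.span Qᵐᵒᵖ (Set.range e) = Submodule.pi Set.univ fun _ ↦ N) (hn : 0 < n)
    {I : TwoSidedIdeal Q} (hI : N.mulTwoSided I = N) : ∃ y ∈ I, 1 - y ∈ relations e := by
  let T : Submodule Qᵐᵒᵖ (Fin l → Q) :=
    { carrier := {x | ∃ q : Fin n → Q, (∀ j, q j ∈ I) ∧ ∑ j, MulOpposite.op (q j) • e j = x}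
      zero_mem' := ⟨0, fun _ ↦ I.zero_mem, by simp⟩
      add_mem' := by
        rintro _ _ ⟨p, hp, rfl⟩ ⟨q, hq, rfl⟩
        exact ⟨p + q, fun j ↦ I.add_mem (hp j) (hq j), by simp [add_smul, Finset.sum_add_distrib]⟩
      smul_mem' := by
        rintro c _ ⟨p, hp, rfl⟩
        exact ⟨fun j ↦ p j * MulOpposite.unop c, fun j ↦ I.mul_mem_right _ _ (hp j),
          by simp [mul_smul, Finset.smul_sum]⟩ }
  have hs (s : Fin l) : N ≤ T.comap (LinearMap.single Qᵐᵒᵖ (fun _ ↦ Q) s) := by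
    rw [← hI]
    refine Submodule.span_le.mpr ?_
    rintro _ ⟨x, hx, y, hy, rfl⟩
    have h1 : Pi.single s x ∈ Submodule.span Qᵐᵒᵖ (Set.range e) := by
      rw [he, Submodule.mem_pi]
      intro i _
      by_cases hi : i = s
      · subst hi; simpa using hx
      · simp [hi]
    obtain ⟨c, hc⟩ := Submodule.mem_span_range_iff_exists_fun Qᵐᵒᵖ |>.mp h1
    refine ⟨fun j ↦ MulOpposite.unop (c j) * y, fun j ↦ I.mul_mem_left _ _ hy, ?_⟩
    have h2 : (Pi.single s (x * y) : Fin l → Q) = MulOpposite.op y • Pi.single s x := by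
      rw [← Pi.single_smul]; rfl
    rw [LinearMap.coe_single, h2, ← hc]
    simp [mul_smul, Finset.smul_sum]
  have hT (x : Fin l → Q) (hx : ∀ i, x i ∈ N) : x ∈ T := by
    rw [← Finset.univ_sum_single x]
    exact Submodule.sum_mem _ fun s _ ↦ hs s (hx s)
  let j : Fin n := ⟨0, hn⟩
  have hej : e j ∈ Submodule.pi Set.univ fun _ ↦ N := he ▸ Submodule.subset_span ⟨j, rfl⟩
  obtain ⟨q, hq, hqe⟩ := hT (e j) fun i ↦ (Submodule.mem_pi.mp hej) i trivial
  refine ⟨q j, hq j, ?_⟩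
  have h1 := mem_relations (e := e) (q := Pi.single j 1 - q) (by
    simp only [Pi.sub_apply, MulOpposite.op_sub, sub_smul, Finset.sum_sub_distrib, hqe]
    rw [Finset.sum_eq_single j (by intro i _ hi; simp [hi]) (by simp)]
    simp) j
  simpa using h1

end RightIdeals

/-! ### Minimal stable right ideals and maximal stable ideals. -/

section Structure

variable {k H Q : Type*} [Field k] [Ring H] [HopfAlgebra k H]
  [Ring Q] [Algebra k Q] [Module H Q] [HModuleAlgebra k H Q]

instance IsSemiprimaryRing.isStablyFiniteRing_quotient [IsSemiprimaryRing Q] (I : Ideal Q)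
    [I.IsTwoSided] : IsStablyFiniteRing (Q ⧸ I) :=
  .of_surjective_of_isNilpotent IsSemiprimaryRing.isNilpotent (Ideal.Quotient.mk I)
    Ideal.Quotient.mk_surjective

/-- A proper `H`-stable two-sided ideal that is maximal among these. -/
def TwoSidedIdeal.IsHMaximal (H : Type*) {Q : Type*} [Ring H] [Ring Q] [Module H Q]
    (I : TwoSidedIdeal Q) : Prop :=
  I.IsHStable H ∧ I ≠ ⊤ ∧ ∀ I' : TwoSidedIdeal Q, I'.IsHStable H → I ≤ I' → I' = I ∨ I' = ⊤

theorem Submodule.finiteDimensional_restrictScalars_pi {k H M ι : Type*} [Field k] [Ring H]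
    [Algebra k H] [AddCommGroup M] [Module k M] [Module H M] [IsScalarTower k H M] [Finite ι]
    (V : Submodule H M) [FiniteDimensional k (V.restrictScalars k)] :
    FiniteDimensional k ((Submodule.pi Set.univ fun _ : ι ↦ V).restrictScalars k) := by
  let f : (Submodule.pi Set.univ fun _ : ι ↦ V).restrictScalars k →ₗ[k]
      (ι → V.restrictScalars k) :=
    { toFun := fun x i ↦ ⟨x.1 i, (Submodule.mem_pi.mp x.2) i trivial⟩
      map_add' := fun x y ↦ rfl
      map_smul' := fun c x ↦ rfl }
  refine Module.Finite.of_injective f fun x y h ↦ ?_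
  ext i
  exact congrArg Subtype.val (congrFun h i)

theorem Submodule.fg_span_mulOpposite (V : Submodule H Q)
    [FiniteDimensional k (V.restrictScalars k)] : (Submodule.span Qᵐᵒᵖ (V : Set Q)).FG := by
  obtain ⟨s, hs⟩ := Module.Finite.iff_fg.mp ‹FiniteDimensional k (V.restrictScalars k)›
  refine ⟨s, le_antisymm (Submodule.span_mono fun x hx ↦ ?_) (Submodule.span_le.mpr fun x hx ↦ ?_)⟩
  · have : x ∈ V.restrictScalars k := hs ▸ Submodule.subset_span hx
    exact this
  · have hx : x ∈ V.restrictScalars k := hx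
    rw [← hs] at hx
    exact Submodule.span_le_restrictScalars k Qᵐᵒᵖ _ hx

/-- The right annihilator of a minimal `H`-stable right ideal generated by a finite-dimensional
`H`-submodule is a maximal `H`-stable ideal. -/
theorem Submodule.exists_isHMaximal_annihilator [IsSemiprimaryRing Q] (V : Submodule H Q)
    [FiniteDimensional k (V.restrictScalars k)] {N : Submodule Qᵐᵒᵖ Q}
    (hNV : N = Submodule.span Qᵐᵒᵖ V) (hN : N.IsHStableRight H) (hN0 : N ≠ ⊥)
    (hmin : ∀ N' : Submodule Qᵐᵒᵖ Q, N'.IsHStableRight H → N' ≤ N → N' = ⊥ ∨ N' = N) :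
    ∃ I : TwoSidedIdeal Q, I.IsHMaximal H ∧ ∀ y, y ∈ I ↔ ∀ x ∈ N, x * y = 0 := by
  obtain ⟨J, _, _, hJ⟩ := IsSemiprimaryRing.exists_ideal_mulOpposite Q
  have hfg : N.FG := hNV ▸ V.fg_span_mulOpposite (k := k)
  have : Module.Finite Qᵐᵒᵖ N := Module.Finite.iff_fg.mpr hfg
  have : Nontrivial N := Submodule.nontrivial_iff_ne_bot.mpr hN0
  obtain ⟨l, n, e₀, S, hl, hn, hS, hspan, hrel⟩ :=
    Module.Finite.exists_span_eq_top_relations_mem hJ N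
  let ψ : (Fin l → N) →ₗ[Qᵐᵒᵖ] (Fin l → Q) := LinearMap.pi fun i ↦ N.subtype ∘ₗ LinearMap.proj i
  have hψ : Function.Injective ψ := fun x y h ↦ funext fun i ↦ Subtype.ext (congrFun h i)
  let e (j : Fin n) : Fin l → Q := ψ (e₀ j)
  have he : Submodule.span Qᵐᵒᵖ (Set.range e) = Submodule.pi Set.univ fun _ ↦ N := by
    have h1 : Set.range e = ψ '' Set.range e₀ := Set.range_comp ψ e₀
    rw [h1, ← Submodule.map_span, hspan, Submodule.map_top]
    ext x
    refine ⟨?_, fun hx ↦ ⟨fun i ↦ ⟨x i, (Submodule.mem_pi.mp hx) i trivial⟩, rfl⟩⟩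
    rintro ⟨y, rfl⟩
    exact Submodule.mem_pi.mpr fun i _ ↦ (y i).2
  have heN (j : Fin n) (i : Fin l) : e j i ∈ N := (e₀ j i).2
  let W : Submodule H (Fin l → Q) := Submodule.pi Set.univ fun _ ↦ V
  have : FiniteDimensional k (W.restrictScalars k) := V.finiteDimensional_restrictScalars_pi
  have heW : Submodule.span Qᵐᵒᵖ (Set.range e) = Submodule.span Qᵐᵒᵖ W := by
    rw [he]
    refine le_antisymm (fun x hx ↦ ?_) (Submodule.span_le.mpr fun x hx ↦ ?_)
    · rw [← Finset.univ_sum_single x]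
      refine Submodule.sum_mem _ fun s _ ↦ ?_
      have h1 : N ≤ (Submodule.span Qᵐᵒᵖ W).comap (LinearMap.single Qᵐᵒᵖ (fun _ ↦ Q) s) := by
        rw [hNV]
        refine Submodule.span_le.mpr fun v hv ↦ Submodule.subset_span ?_
        refine Submodule.mem_pi.mpr fun i _ ↦ ?_
        by_cases hi : i = s
        · subst hi; simpa using hv
        · simp [hi]
      exact h1 ((Submodule.mem_pi.mp hx) s trivial)
    · refine Submodule.mem_pi.mpr fun i _ ↦ ?_
      rw [hNV]
      exact Submodule.subset_span ((Submodule.mem_pi.mp hx) i trivial)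
  let I := TwoSidedIdeal.relations e
  have hI : I.IsHStable H := TwoSidedIdeal.isHStable_relations (k := k) W heW
  -- The proper ideal containing all relation coefficients keeps $I$ proper.
  have hIS : I ≤ S.unop := by
    refine TwoSidedIdeal.span_le.mpr ?_
    rintro _ ⟨q, hq, j, rfl⟩
    refine TwoSidedIdeal.mem_unop_iff.mpr (hrel (fun j ↦ MulOpposite.op (q j)) (hψ ?_) j)
    simpa [e] using hq
  have hI1 : (1 : Q) ∉ I := fun h ↦ hS ((TwoSidedIdeal.one_mem_iff _).mp
    (TwoSidedIdeal.mem_unop_iff.mp (hIS h)))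
  have hdich {I' : TwoSidedIdeal Q} (hI' : I'.IsHStable H) (hle : I ≤ I')
      (hN' : N.mulTwoSided I' = N) : I' = ⊤ := by
    obtain ⟨y, hy, hy'⟩ := TwoSidedIdeal.exists_mem_one_sub_mem_relations he hn hN'
    rw [← TwoSidedIdeal.one_mem_iff]
    simpa using I'.add_mem (hle hy') hy
  have hann {I' : TwoSidedIdeal Q} (h : N.mulTwoSided I' = ⊥) (x) (hx : x ∈ N) (y) (hy : y ∈ I') :
      x * y = 0 := by
    rw [← Submodule.mem_bot Qᵐᵒᵖ, ← h]
    exact Submodule.subset_span ⟨x, hx, y, hy, rfl⟩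
  have hmem (y : Q) (hy : ∀ x ∈ N, x * y = 0) : y ∈ I := by
    have h1 := TwoSidedIdeal.mem_relations (e := e) (q := fun _ ↦ y) (by
      ext i
      simp [hy _ (heN _ _)]) ⟨0, hn⟩
    exact h1
  -- Otherwise $NI=N$ by minimality, which would give $I=Q$.
  have hNI : N.mulTwoSided I = ⊥ :=
    (hmin _ (hN.mulTwoSided k hI) Submodule.mulTwoSided_le).resolve_right fun h ↦
      hI1 ((TwoSidedIdeal.one_mem_iff _).mpr (hdich hI le_rfl h))
  refine ⟨I, ⟨hI, fun h ↦ hI1 ((TwoSidedIdeal.one_mem_iff _).mpr h), fun I' hI' hle ↦ ?_⟩,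
    fun y ↦ ⟨fun hy x hx ↦ hann hNI x hx y hy, hmem y⟩⟩
  rcases hmin _ (hN.mulTwoSided k hI') Submodule.mulTwoSided_le with h | h
  · exact Or.inl (le_antisymm (fun y hy ↦ hmem y fun x hx ↦ hann h x hx y hy) hle)
  · exact Or.inr (hdich hI' hle h)

/-- A minimal member among those generated by finite-dimensional $H$-submodules is minimal among all
nonzero stable right ideals, because each of the latter inside $K$ contains one of the former. -/
theorem Submodule.exists_minimal_isHStableRight [IsSemiprimaryRing Q]
    (A : Subalgebra k Q) (hfin : A.IsLocallyFinite H)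
    (hess : ∀ I : Submodule Qᵐᵒᵖ Q, I ≠ ⊥ → ∃ x ∈ I, x ∈ A ∧ x ≠ 0)
    {K : Submodule Qᵐᵒᵖ Q} (hK : K.IsHStableRight H) (hK0 : K ≠ ⊥) :
    ∃ V : Submodule H Q, FiniteDimensional k (V.restrictScalars k) ∧
      Submodule.span Qᵐᵒᵖ (V : Set Q) ≤ K ∧ Submodule.span Qᵐᵒᵖ (V : Set Q) ≠ ⊥ ∧
      ∀ N' : Submodule Qᵐᵒᵖ Q, N'.IsHStableRight H → N' ≤ Submodule.span Qᵐᵒᵖ (V : Set Q) →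
        N' = ⊥ ∨ N' = Submodule.span Qᵐᵒᵖ (V : Set Q) := by
  obtain ⟨J, _, _, hJ⟩ := IsSemiprimaryRing.exists_ideal_mulOpposite Q
  let 𝒮 : Set (Submodule Qᵐᵒᵖ Q) := {N | N ≤ K ∧ N ≠ ⊥ ∧ ∃ V : Submodule H Q,
    FiniteDimensional k (V.restrictScalars k) ∧ N = Submodule.span Qᵐᵒᵖ (V : Set Q)}
  have hex (K' : Submodule Qᵐᵒᵖ Q) (hK' : K'.IsHStableRight H) (h0 : K' ≠ ⊥) (hle : K' ≤ K) :
      ∃ N ∈ 𝒮, N ≤ K' := by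
    obtain ⟨x, hx, hxA, hx0⟩ := hess K' h0
    have h1 : Submodule.span Qᵐᵒᵖ (Submodule.span H {x} : Set Q) ≤ K' := by
      refine Submodule.span_le.mpr fun y hy ↦ ?_
      obtain ⟨h, rfl⟩ := Submodule.mem_span_singleton.mp hy
      exact hK' h x hx
    refine ⟨_, ⟨h1.trans hle, fun h ↦ hx0 ?_, _, hfin x hxA, rfl⟩, h1⟩
    rw [← Submodule.mem_bot Qᵐᵒᵖ, ← h]
    exact Submodule.subset_span (Submodule.mem_span_singleton_self x)
  obtain ⟨N, ⟨hNK, hN0, V, hV, rfl⟩, hmin⟩ := Submodule.exists_minimal_of_fg (S := 𝒮) hJ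
    (let ⟨N, hN, _⟩ := hex K hK hK0 le_rfl; ⟨N, hN⟩) (by
      rintro _ ⟨-, -, V, hV, rfl⟩
      exact V.fg_span_mulOpposite (k := k))
  refine ⟨V, hV, hNK, hN0, fun N' hN' hle ↦ ?_⟩
  by_cases h0 : N' = ⊥
  · exact Or.inl h0
  · obtain ⟨N'', hN'', hle'⟩ := hex N' hN' h0 (hle.trans hNK)
    have := hmin N'' hN'' (hle'.trans hle)
    exact Or.inr (le_antisymm hle (this ▸ hle'))

theorem TwoSidedIdeal.isHStable_span (k : Type*) {H Q : Type*} [Field k] [Ring H]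
    [HopfAlgebra k H] [Ring Q] [Algebra k Q] [Module H Q] [HModuleAlgebra k H Q] {s : Set Q}
    (hs : ∀ (h : H), ∀ x ∈ s, h • x ∈ TwoSidedIdeal.span s) :
    (TwoSidedIdeal.span s).IsHStable H :=
  (isHStable_iff_le_stableCore (k := k)).mpr
    (span_le.mpr fun x hx ↦ mem_stableCore.mpr fun h ↦ hs h x hx)

/-- In an `H`-semiprime algebra, no nonzero `H`-stable right ideal has square zero. -/
theorem IsHSemiprime.eq_bot_of_mul_eq_zero (k : Type*) {H Q : Type*} [Field k] [Ring H]
    [HopfAlgebra k H] [Ring Q] [Algebra k Q] [Module H Q] [HModuleAlgebra k H Q]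
    (hsp : IsHSemiprime H Q) {N : Submodule Qᵐᵒᵖ Q} (hN : N.IsHStableRight H)
    (h0 : ∀ x ∈ N, ∀ y ∈ N, x * y = 0) : N = ⊥ := by
  let I := TwoSidedIdeal.span (N : Set Q)
  have hI : I.IsHStable H := TwoSidedIdeal.isHStable_span k fun h x hx ↦
    TwoSidedIdeal.subset_span (hN h x hx)
  -- $N$ is a right ideal, so $N(QNQ)\subseteq N\cdot NQ=0$.
  have h1 (y : Q) (hy : y ∈ I) : ∀ x ∈ N, x * y = 0 := by
    induction hy using TwoSidedIdeal.span_induction with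
    | mem y hy => exact fun x hx ↦ h0 x hx y hy
    | zero => simp
    | add a b _ _ ha hb => exact fun x hx ↦ by rw [mul_add, ha x hx, hb x hx, add_zero]
    | neg a _ ha => exact fun x hx ↦ by rw [mul_neg, ha x hx, neg_zero]
    | left_absorb a b _ hb =>
      exact fun x hx ↦ by rw [← mul_assoc]; exact hb _ (N.smul_mem (MulOpposite.op a) hx)
    | right_absorb a b _ hb => exact fun x hx ↦ by rw [← mul_assoc, hb x hx, zero_mul]
  have h2 (x : Q) (hx : x ∈ I) : ∀ y ∈ I, x * y = 0 := by
    induction hx using TwoSidedIdeal.span_induction with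
    | mem x hx => exact fun y hy ↦ h1 y hy x hx
    | zero => simp
    | add a b _ _ ha hb => exact fun x hx ↦ by rw [add_mul, ha x hx, hb x hx, add_zero]
    | neg a _ ha => exact fun x hx ↦ by rw [neg_mul, ha x hx, neg_zero]
    | left_absorb a b _ hb => exact fun x hx ↦ by rw [mul_assoc, hb x hx, mul_zero]
    | right_absorb a b _ hb =>
      exact fun x hx ↦ by rw [mul_assoc]; exact hb _ (I.mul_mem_left _ _ hx)
  have h3 : IsNilpotent (TwoSidedIdeal.asIdeal I) := by
    refine ⟨2, ?_⟩
    rw [Submodule.zero_eq_bot, eq_bot_iff, Submodule.pow_succ, Submodule.pow_one, Ideal.mul_le]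
    exact fun x hx y hy ↦ h2 x hx y hy
  have h4 := hsp I hI h3
  rw [eq_bot_iff]
  intro x hx
  have h5 : x ∈ I := TwoSidedIdeal.subset_span hx
  rw [h4] at h5
  exact h5

theorem TwoSidedIdeal.sInf_isHMaximal_eq_bot [IsSemiprimaryRing Q] (hsp : IsHSemiprime H Q)
    (A : Subalgebra k Q) (hfin : A.IsLocallyFinite H)
    (hess : ∀ I : Submodule Qᵐᵒᵖ Q, I ≠ ⊥ → ∃ x ∈ I, x ∈ A ∧ x ≠ 0) :
    sInf {I : TwoSidedIdeal Q | I.IsHMaximal H} = ⊥ := by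
  by_contra hne
  let T := {I : TwoSidedIdeal Q | I.IsHMaximal H}
  let K : Submodule Qᵐᵒᵖ Q :=
    { carrier := {x | x ∈ sInf T}
      zero_mem' := (sInf T).zero_mem
      add_mem' := (sInf T).add_mem
      smul_mem' := fun c x hx ↦ (sInf T).mul_mem_right _ _ hx }
  have hK : K.IsHStableRight H := by
    intro h x hx
    have hx : x ∈ sInf T := hx
    have hhx : h • x ∈ sInf T := by
      rw [TwoSidedIdeal.mem_sInf] at hx ⊢
      exact fun I hI ↦ hI.1 h x (hx I hI)
    exact hhx
  have hK0 : K ≠ ⊥ := by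
    intro h
    refine hne (eq_bot_iff.mpr fun x hx ↦ ?_)
    have hx : x ∈ K := hx
    rw [h] at hx
    exact hx
  obtain ⟨V, hV, hle, h0, hmin⟩ := Submodule.exists_minimal_isHStableRight A hfin hess hK hK0
  have hVs := Submodule.isHStableRight_span (s := (V : Set Q)) k fun (h : H) x hx ↦
    Submodule.subset_span (V.smul_mem h hx)
  obtain ⟨I, hI, hann⟩ := V.exists_isHMaximal_annihilator (k := k) rfl hVs h0 hmin
  exact h0 (hsp.eq_bot_of_mul_eq_zero k hVs fun x hx y hy ↦
    (hann y).mp (((TwoSidedIdeal.mem_sInf _).mp (hle hy : y ∈ sInf T)) I hI) x hx)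

end Structure

/-! ### Comaximal ideals and the product decomposition. -/

section Decomposition

theorem TwoSidedIdeal.exists_one_sub_mem_of_coprime {Q ι : Type*} [Ring Q] {I : TwoSidedIdeal Q}
    {L : ι → TwoSidedIdeal Q} (s : Finset ι) (h : ∀ j ∈ s, ∃ y ∈ L j, 1 - y ∈ I) :
    ∃ e, 1 - e ∈ I ∧ ∀ j ∈ s, e ∈ L j := by
  classical
  induction s using Finset.induction_on with
  | empty => exact ⟨1, by simp [I.zero_mem], by simp⟩
  | insert i s _ ih =>
    obtain ⟨e, he, hes⟩ := ih fun j hj ↦ h j (Finset.mem_insert_of_mem hj)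
    obtain ⟨y, hy, hyI⟩ := h i (Finset.mem_insert_self i s)
    refine ⟨e * y, ?_, fun j hj ↦ ?_⟩
    · have h1 : 1 - e * y = (1 - e) + e * (1 - y) := by noncomm_ring
      rw [h1]
      exact I.add_mem he (I.mul_mem_left _ _ hyI)
    · rcases Finset.mem_insert.mp hj with rfl | hj
      · exact (L j).mul_mem_left _ _ hy
      · exact (L j).mul_mem_right _ _ (hes j hj)

/-- The **Chinese remainder theorem** for finitely many pairwise comaximal two-sided ideals with
zero intersection. -/
theorem TwoSidedIdeal.bijective_pi_quotientMk {Q ι : Type*} [Ring Q] [Finite ι]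
    {L : ι → TwoSidedIdeal Q} (h : ∀ i j, i ≠ j → ∃ y ∈ L j, 1 - y ∈ L i)
    (h0 : ∀ x, (∀ i, x ∈ L i) → x = 0) :
    Function.Bijective fun (x : Q) (i : ι) ↦ Ideal.Quotient.mk (L i).asIdeal x := by
  classical
  have := Fintype.ofFinite ι
  constructor
  · intro x y hxy
    refine sub_eq_zero.mp (h0 _ fun i ↦ ?_)
    exact Ideal.Quotient.eq.mp (congrFun hxy i)
  · intro z
    choose x hx using fun i ↦ Ideal.Quotient.mk_surjective (z i)
    choose e he he' using fun i ↦ exists_one_sub_mem_of_coprime (I := L i) (L := L)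
      (Finset.univ.erase i) fun j hj ↦ h i j (Finset.ne_of_mem_erase hj).symm
    refine ⟨∑ i, x i * e i, funext fun j ↦ ?_⟩
    rw [← hx j]
    refine Ideal.Quotient.eq.mpr ?_
    rw [← Finset.add_sum_erase _ _ (Finset.mem_univ j), add_comm, add_sub_assoc]
    refine (L j).add_mem ((L j).finsetSum_mem _ _ fun i hi ↦ (L j).mul_mem_left _ _
      (he' i j (Finset.mem_erase.mpr ⟨(Finset.ne_of_mem_erase hi).symm, Finset.mem_univ j⟩))) ?_
    have h1 : x j * e j - x j = -(x j * (1 - e j)) := by noncomm_ring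
    rw [h1]
    exact (L j).neg_mem ((L j).mul_mem_left _ _ (he j))

/-- A family of pairwise comaximal proper two-sided ideals of a semiprimary ring is finite. -/
theorem IsSemiprimaryRing.finite_of_pairwise_comaximal {Q : Type*} [Ring Q] [IsSemiprimaryRing Q]
    {T : Set (TwoSidedIdeal Q)} (hT : ∀ I ∈ T, I ≠ ⊤)
    (h : ∀ I ∈ T, ∀ L ∈ T, I ≠ L → ∃ y ∈ L, 1 - y ∈ I) : T.Finite := by
  classical
  let J := Ring.jacobson Q
  have : IsArtinian Q (Q ⧸ J) := by
    have : IsSemisimpleModule Q (Q ⧸ J) := by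
      refine J.isSemisimpleModule_of_smul_eq_zero fun r hr b ↦ ?_
      obtain ⟨b, rfl⟩ := Ideal.Quotient.mk_surjective b
      exact Ideal.Quotient.eq_zero_iff_mem.mpr (J.mul_mem_right b hr)
    have := IsSemisimpleModule.finite_tfae (R := Q) (M := Q ⧸ J)
    exact (this.out 0 2).mp (inferInstance : Module.Finite Q _)
  let f (F : Finset (TwoSidedIdeal Q)) : Submodule Q (Q ⧸ J) :=
    Submodule.map J.mkQ (⨅ I ∈ F, TwoSidedIdeal.asIdeal I)
  -- Choose a finite intersection with minimal image modulo the radical; any further $I$ leaves this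
  -- image unchanged.
  obtain ⟨_, ⟨F, hF, rfl⟩, hmin⟩ := IsArtinian.set_has_minimal (f '' {F | ↑F ⊆ T})
    ⟨_, ∅, by simp, rfl⟩
  refine F.finite_toSet.subset fun I hI ↦ ?_
  by_contra hIF
  obtain ⟨z, hzI, hzF⟩ := TwoSidedIdeal.exists_one_sub_mem_of_coprime (I := I) (L := id) F
    fun L hL ↦ h I hI L (hF hL) fun hIL ↦ hIF (hIL ▸ hL)
  have hle : f (insert I F) ≤ f F := Submodule.map_mono
    (biInf_mono fun L (hL : L ∈ F) ↦ Finset.mem_insert_of_mem hL)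
  have heq : f (insert I F) = f F := by
    by_contra hne
    refine hmin _ ⟨insert I F, ?_, rfl⟩ (lt_of_le_of_ne hle hne)
    simpa [Set.insert_subset_iff, hI] using hF
  have hz : J.mkQ z ∈ f (insert I F) := by
    rw [heq]
    exact Submodule.mem_map_of_mem (by simpa using hzF)
  obtain ⟨z', hz', hzz'⟩ := hz
  have hz'I : z' ∈ I := by
    have h1 : z' ∈ ⨅ L ∈ insert I F, TwoSidedIdeal.asIdeal L := hz'
    simp only [Submodule.mem_iInf] at h1
    exact h1 I (Finset.mem_insert_self I F)
  have hj : z - z' ∈ J := (Submodule.Quotient.eq J).mp hzz'.symm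
  -- Now $z\equiv 1$ and $z'\equiv 0$ modulo $I$, while $z-z'$ is nilpotent: the proper ideal $I$
  -- would contain the unit $1-(z-z')$.
  have hunit : IsUnit (1 - (z - z')) := by
    obtain ⟨t, ht⟩ := IsSemiprimaryRing.isNilpotent (R := Q)
    refine IsNilpotent.isUnit_one_sub ⟨t, ?_⟩
    have := Ideal.pow_mem_pow hj t
    rw [ht] at this
    exact this
  have hmem : 1 - (z - z') ∈ I := by
    have h1 : 1 - (z - z') = (1 - z) + z' := by abel
    rw [h1]
    exact I.add_mem hzI hz'I
  obtain ⟨u, hu⟩ := hunit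
  refine hT I hI ((TwoSidedIdeal.one_mem_iff _).mp ?_)
  rw [← u.inv_mul, hu]
  exact I.mul_mem_left _ _ hmem

/-- The `H`-module structure on the quotient by an `H`-stable two-sided ideal. -/
@[reducible] noncomputable def TwoSidedIdeal.IsHStable.quotientModule {H Q : Type*} [Ring H]
    [Ring Q] [Module H Q] {I : TwoSidedIdeal Q} (hI : I.IsHStable H) : Module H (Q ⧸ I.asIdeal) :=
  let _ : SMul H (Q ⧸ I.asIdeal) :=
    ⟨fun h ↦ Quotient.map (h • ·) fun x y hxy ↦ 
      (Submodule.quotientRel_def I.asIdeal).mpr (by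
        rw [← smul_sub]
        exact hI h _ ((Submodule.quotientRel_def I.asIdeal).mp hxy))⟩
  Function.Surjective.module H (Ideal.Quotient.mk I.asIdeal).toAddMonoidHom
    Ideal.Quotient.mk_surjective fun _ _ ↦ rfl

theorem TwoSidedIdeal.IsHStable.smul_mk {H Q : Type*} [Ring H] [Ring Q]
    [Module H Q] {I : TwoSidedIdeal Q} (hI : I.IsHStable H) (h : H) (x : Q) :
    letI := hI.quotientModule
    h • Ideal.Quotient.mk I.asIdeal x = Ideal.Quotient.mk I.asIdeal (h • x) := rfl

theorem TwoSidedIdeal.IsHStable.hModuleAlgebra_quotient {k H Q : Type*} [Field k] [Ring H]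
    [HopfAlgebra k H] [Ring Q] [Algebra k Q] [Module H Q] [HModuleAlgebra k H Q]
    {I : TwoSidedIdeal Q} (hI : I.IsHStable H) :
    letI := hI.quotientModule
    HModuleAlgebra k H (Q ⧸ I.asIdeal) :=
  letI := hI.quotientModule
  { smul_assoc := fun c h x ↦ by
      obtain ⟨x, rfl⟩ := Ideal.Quotient.mk_surjective x
      exact congrArg (Ideal.Quotient.mk I.asIdeal) (smul_assoc c h x)
    smul_mul_eq := fun h x y ↦ by
      obtain ⟨x, rfl⟩ := Ideal.Quotient.mk_surjective x
      obtain ⟨y, rfl⟩ := Ideal.Quotient.mk_surjective y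
      let r := Coalgebra.Repr.arbitrary k h
      rw [← map_mul, hI.smul_mk, HModuleAlgebra.smul_mul_repr r, ← r.eq]
      simp [hI.smul_mk] }

theorem TwoSidedIdeal.IsHMaximal.isHSimple_quotient {H Q : Type*} [Ring H] [Ring Q]
    [Module H Q] {I : TwoSidedIdeal Q} (hI : I.IsHMaximal H) :
    letI := hI.1.quotientModule
    IsHSimple H (Q ⧸ I.asIdeal) := by
  let _ := hI.1.quotientModule
  have hmem (L : TwoSidedIdeal (Q ⧸ I.asIdeal)) (x : Q) :
      x ∈ L.comap (Ideal.Quotient.mk I.asIdeal) ↔ Ideal.Quotient.mk I.asIdeal x ∈ L :=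
    TwoSidedIdeal.mem_comap _
  refine ⟨Ideal.Quotient.nontrivial_iff.mpr fun h ↦ hI.2.1 ?_, fun L hL ↦ ?_⟩
  · rw [← TwoSidedIdeal.one_mem_iff, ← TwoSidedIdeal.mem_asIdeal, h]
    trivial
  · rcases hI.2.2 (L.comap (Ideal.Quotient.mk I.asIdeal))
      (fun h x hx ↦ (hmem L _).mpr (hL h _ ((hmem L x).mp hx)))
      (fun x hx ↦ (hmem L x).mpr
        (by rw [Ideal.Quotient.eq_zero_iff_mem.mpr hx]; exact L.zero_mem)) with h | h
    · refine Or.inl (eq_bot_iff.mpr fun x hx ↦ ?_)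
      obtain ⟨x, rfl⟩ := Ideal.Quotient.mk_surjective x
      rw [← hmem, h] at hx
      exact Ideal.Quotient.eq_zero_iff_mem.mpr hx
    · refine Or.inr ((TwoSidedIdeal.one_mem_iff _).mp ?_)
      rw [← map_one (Ideal.Quotient.mk I.asIdeal), ← hmem, h]
      trivial

theorem TwoSidedIdeal.IsHMaximal.exists_one_sub_mem {H Q : Type*} [Ring H] [Ring Q]
    [Module H Q] {I L : TwoSidedIdeal Q} (hI : I.IsHMaximal H) (hL : L.IsHMaximal H)
    (hne : I ≠ L) : ∃ y ∈ L, 1 - y ∈ I := by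
  have hsup : (I ⊔ L).IsHStable H := by
    intro h x hx
    obtain ⟨a, ha, b, hb, rfl⟩ := TwoSidedIdeal.mem_sup.mp hx
    rw [smul_add]
    exact TwoSidedIdeal.mem_sup.mpr ⟨_, hI.1 h a ha, _, hL.1 h b hb, rfl⟩
  have htop : I ⊔ L = ⊤ := by
    refine (hI.2.2 _ hsup le_sup_left).resolve_left fun h ↦ ?_
    have hle : L ≤ I := h ▸ le_sup_right
    rcases hL.2.2 I hI.1 hle with h' | h'
    · exact hne h'
    · exact hI.2.1 h'
  obtain ⟨a, ha, b, hb, hab⟩ := TwoSidedIdeal.mem_sup.mp ((TwoSidedIdeal.one_mem_iff _).mpr htop)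
  exact ⟨b, hb, by rwa [← hab, add_sub_cancel_right]⟩

end Decomposition

theorem proposition3p2 {k : Type u} {H : Type w} {Q : Type v} [Field k] [Ring H] [HopfAlgebra k H]
    [Ring Q] [Algebra k Q] [Module H Q] [HModuleAlgebra k H Q]
    (hQ : IsSemiprimaryRing Q) (hsp : IsHSemiprime H Q)
    (A : Subalgebra k Q) (hA : A.IsHStable H) (hfin : A.IsLocallyFinite H)
    (hess : ∀ I : Submodule Qᵐᵒᵖ Q, I ≠ ⊥ → ∃ x ∈ I, x ∈ A ∧ x ≠ 0) :
    ∃ (n : ℕ) (R : Fin n → Type v) (_ : ∀ i, Ring (R i)) (_ : ∀ i, Algebra k (R i))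
      (_ : ∀ i, Module H (R i)) (_ : ∀ i, HModuleAlgebra k H (R i)),
      (∀ i, IsHSimple H (R i)) ∧
        ∃ e : Q ≃ₐ[k] (∀ i, R i), ∀ (h : H) (q : Q), e (h • q) = h • e q := by
  have hinf := TwoSidedIdeal.sInf_isHMaximal_eq_bot hsp A hfin hess
  let T := {I : TwoSidedIdeal Q | I.IsHMaximal H}
  have hT : T.Finite := IsSemiprimaryRing.finite_of_pairwise_comaximal (fun I hI ↦ hI.2.1)
    fun I hI L hL hne ↦ hI.exists_one_sub_mem hL hne
  have : Finite T := hT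
  obtain ⟨n, ⟨φ⟩⟩ := Finite.exists_equiv_fin T
  let L (i : Fin n) : TwoSidedIdeal Q := φ.symm i
  have hL (i : Fin n) : (L i).IsHMaximal H := (φ.symm i).2
  have hbij : Function.Bijective fun (x : Q) (i : Fin n) ↦ Ideal.Quotient.mk (L i).asIdeal x := by
    refine TwoSidedIdeal.bijective_pi_quotientMk
      (fun i j hij ↦ (hL i).exists_one_sub_mem (hL j) fun h ↦
        hij (φ.symm.injective (Subtype.ext h))) fun x hx ↦ ?_
    have h1 : x ∈ sInf T := (TwoSidedIdeal.mem_sInf _).mpr fun I hI ↦ by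
      simpa [L] using hx (φ ⟨I, hI⟩)
    rw [hinf] at h1
    exact h1
  exact ⟨n, fun i ↦ Q ⧸ (L i).asIdeal, fun _ ↦ inferInstance, fun _ ↦ inferInstance,
    fun i ↦ (hL i).1.quotientModule, fun i ↦ (hL i).1.hModuleAlgebra_quotient,
    fun i ↦ (hL i).isHSimple_quotient,
    AlgEquiv.ofBijective (AlgHom.pi fun i ↦ Ideal.Quotient.mkₐ k (L i).asIdeal) hbij,
    fun _ _ ↦ rfl⟩
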